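/- Let $n\ge 1$ and let $S\subset\mathbb{R}^{n+1}$ be a compact $C^2$ hypersurface that is the boundary of a bounded convex domain. Let $\nu$ denote Euclidean surface measure on $S$. For $v\in\mathbb{R}^{n+1}$ with $|v|=1$ and real $t\neq 0$ put $$a(v,t)=\sup_{s\in\mathbb{R}}\nu\big(\{x\in S:\ s\le x\cdot v\le s+|t|^{-1}\}\big),$$ and for a real-valued function $\psi$ that is $C^1$ on a neighborhood of $S$ in $\mathbb{R}^{n+1}$ put $$\widehat{\psi\nu}(\lambda)=\int_S e^{-i\lambda\cdot x}\,\psi(x)\,d\nu(x),\qquad \lambda\in\mathbb{R}^{n+1}.$$ Let $0<\alpha<1$. 1. Let $\psi$ be a real-valued $C^1$ function on a neighborhood of $S$. If there is a constant $C>0$ such that $a(v,t)\le C|t|^{-\alpha}$ for all $v$ with $|v|=1$ and all $t\ne 0$, then there is a constant $C'$, depending on $S$, $\psi$ and $\alpha$, such that $|\widehat{\psi\nu}(\lambda)|\le C'|\lambda|^{-\alpha}$ for all $\lambda\neq 0$. 2. Conversely, there is a constant $C>0$, depending only on $S$ and $\alpha$, with the following property. If $\psi$ is a real-valued $C^1$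 function on a neighborhood of $S$ with $\psi(x)>0$ for all $x\in S$, and there is a constant $C'$ such that $|\widehat{\psi\nu}(\lambda)|\le C'|\lambda|^{-\alpha}$ for all $\lambda\ne 0$, then $a(v,t)\le C|t|^{-\alpha}$ for all $v$ with $|v|=1$ and all $t\ne 0$. -/

import Mathlib

open MeasureTheory Filter Topology
open scoped ENNReal

/-- `S ⊆ ℝⁿ⁺¹` is an (embedded) `C²` hypersurface: near each of its points `p`, after a rigid motion
`A` of `ℝⁿ⁺¹` onto `ℝⁿ × ℝ` (with the Euclidean norm) that takes `p` to the origin and the tangent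
plane at `p` to `ℝⁿ × {0}`, it is the graph of a `C²` function `f` of the first `n` variables. -/
def IsC2Hypersurface (n : ℕ) (S : Set (EuclideanSpace ℝ (Fin (n + 1)))) : Prop :=
  ∀ p ∈ S,
    ∃ (A : EuclideanSpace ℝ (Fin (n + 1)) ≃ᵃⁱ[ℝ] WithLp 2 (EuclideanSpace ℝ (Fin n) × ℝ))
      (f : EuclideanSpace ℝ (Fin n) → ℝ),
      A p = 0 ∧ ContDiffAt ℝ 2 f 0 ∧ f 0 = 0 ∧ fderiv ℝ f 0 = 0 ∧
        ∀ᶠ x in 𝓝 p, (x ∈ S ↔ (A x).snd = f (A x).fst)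

/-- `S` is the boundary of a bounded convex domain (nonempty convex open set). -/
def BoundsConvexDomain {n : ℕ} (S : Set (EuclideanSpace ℝ (Fin (n + 1)))) : Prop :=
  ∃ Ω : Set (EuclideanSpace ℝ (Fin (n + 1))),
    Ω.Nonempty ∧ IsOpen Ω ∧ Convex ℝ Ω ∧ Bornology.IsBounded Ω ∧ frontier Ω = S

/-- Euclidean surface measure on `S ⊆ ℝⁿ⁺¹`: the `n`-dimensional Hausdorff measure, normalized to
agree with Lebesgue measure on `ℝⁿ`, restricted to `S`. -/
noncomputable def surfaceMeasure {n : ℕ} (S : Set (EuclideanSpace ℝ (Fin (n + 1)))) :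
    Measure (EuclideanSpace ℝ (Fin (n + 1))) :=
  (μHE[n] : Measure (EuclideanSpace ℝ (Fin (n + 1)))).restrict S

/-- `a(v,t)`: the supremum of the surface measure of `{x ∈ S : s ≤ x · v ≤ s + |t|⁻¹}` over all
real `s`, with values in `[0, ∞]`. -/
noncomputable def slabMeasure {n : ℕ} (S : Set (EuclideanSpace ℝ (Fin (n + 1))))
    (v : EuclideanSpace ℝ (Fin (n + 1))) (t : ℝ) : ℝ≥0∞ :=
  ⨆ s : ℝ, surfaceMeasure S {x | x ∈ S ∧ s ≤ inner ℝ x v ∧ inner ℝ x v ≤ s + |t|⁻¹}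

/-- The Fourier transform of `ψ ν` at `ξ`, where `ν` is surface measure on `S`:
`∫_S exp(-i ξ · x) ψ(x) dν(x)`. -/
noncomputable def surfaceFourier {n : ℕ} (S : Set (EuclideanSpace ℝ (Fin (n + 1))))
    (ψ : EuclideanSpace ℝ (Fin (n + 1)) → ℝ) (ξ : EuclideanSpace ℝ (Fin (n + 1))) : ℂ :=
  ∫ x, Complex.exp (-Complex.I * ((inner ℝ ξ x : ℝ) : ℂ)) * (ψ x : ℂ) ∂(surfaceMeasure S)

/-- `a(v,t) ≤ C |t|^{-α}` for all directions `v` and all `t ≠ 0`. -/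
def SlabBound {n : ℕ} (S : Set (EuclideanSpace ℝ (Fin (n + 1)))) (α C : ℝ) : Prop :=
  ∀ v : EuclideanSpace ℝ (Fin (n + 1)), ‖v‖ = 1 → ∀ t : ℝ, t ≠ 0 →
    slabMeasure S v t ≤ ENNReal.ofReal (C * |t| ^ (-α))

/-- `|(ψ ν)^(ξ)| ≤ C' |ξ|^{-α}` for all `ξ ≠ 0`. -/
def FourierBound {n : ℕ} (S : Set (EuclideanSpace ℝ (Fin (n + 1))))
    (ψ : EuclideanSpace ℝ (Fin (n + 1)) → ℝ) (α C' : ℝ) : Prop :=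
  ∀ ξ : EuclideanSpace ℝ (Fin (n + 1)), ξ ≠ 0 → ‖surfaceFourier S ψ ξ‖ ≤ C' * ‖ξ‖ ^ (-α)

/-- `ψ` is `C¹` on a neighborhood of `S` (its values off that neighborhood play no role). -/
def IsC1Near {n : ℕ} (S : Set (EuclideanSpace ℝ (Fin (n + 1))))
    (ψ : EuclideanSpace ℝ (Fin (n + 1)) → ℝ) : Prop :=
  ∃ U : Set (EuclideanSpace ℝ (Fin (n + 1))), IsOpen U ∧ S ⊆ U ∧ ContDiffOn ℝ 1 ψ U

/-! ### Area formula for parametrized surfaces with a `1`-Lipschitz left inverse -/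

section AreaFormula

open Measure Module

/-! From slabs to Fourier decay. A partition of unity reduces matters to a density supported in one
graph chart. There `ξ · x` becomes `t g` with `t = ‖ξ‖`, and `g` is convex after replacing `ξ` by
`-ξ` if necessary, which only conjugates the transform because `ψ` is real
(`BoundsConvexDomain.exists_sign_tangent_le` supplies the convexity). Let `x₀` minimize `g` on a
closed ball, let `X = x - x₀` be the radial field and `D = Xg`. Convexity gives `D ≥ g - g x₀ ≥ 0`
and `XD ≥ 0`. Integrating by parts along `X` with the weight `q = 1/(1 + tD)` turns the oscillatory
integral into terms of size `q`, plus one containing `Xq`. That term has a sign, so a second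
integration by parts, against a cutoff dominating the amplitude, brings it back to size `q` as well.
Hence the integral is at most a constant times `∫ 1/(1 + t(g - g x₀))`
(`norm_integral_exp_mul_le_integral_inv`). Its layers are the sublevel sets `g ≤ g x₀ + s`, which
are projections of pieces of slabs, and the slab bound yields `t ^ (-α)` because `α < 1`
(`integral_inv_one_add_mul_le`).

From Fourier decay to slabs. A Gaussian in `x · v` at scale `|t|⁻¹` dominates a multiple of the
indicator of the slab. By Fubini its integral against `ψ ν` is a Gaussian average of the Fourier
transform along the line `ℝ v`, and `|ξ| ^ (-α)` is integrable at the origin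
(`exists_slabBound_of_fourierBound`).

Both directions work with Hausdorff measure on `S`; the area formula for graphs,
`map_restrict_euclideanHausdorffMeasure_image`, translates it to Lebesgue measure in a chart. -/

theorem euclideanHausdorffMeasure_image_le_of_dist_le {X Y Z : Type*} [MetricSpace X]
    [MeasurableSpace X] [BorelSpace X] [MetricSpace Y] [MeasurableSpace Y] [BorelSpace Y]
    {Φ : Z → X} {Ψ : Z → Y} {s : Set Z} {K : NNReal} (d : ℕ)
    (h : ∀ x ∈ s, ∀ y ∈ s, dist (Φ x) (Φ y) ≤ K * dist (Ψ x) (Ψ y)) :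
    μHE[d] (Φ '' s) ≤ (K : ℝ≥0∞) ^ d * μHE[d] (Ψ '' s) := by
  rcases s.eq_empty_or_nonempty with rfl | ⟨z, hz⟩
  · simp
  have : Nonempty Z := ⟨z⟩
  -- By `h`, points with equal `Ψ` have equal `Φ`, so `Φ` factors through `Ψ` on `s`, and the factor
  -- is `K`-Lipschitz whichever inverse of `Ψ` is chosen.
  have key : Φ '' s = (Φ ∘ Function.invFunOn Ψ s) '' (Ψ '' s) := by
    rw [Set.image_image]
    refine Set.image_congr fun x hx => ?_
    have hm : Ψ x ∈ Ψ '' s := Set.mem_image_of_mem _ hx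
    have := h x hx _ (Function.invFunOn_mem hm)
    rw [Function.invFunOn_eq hm, dist_self, mul_zero] at this
    simpa using dist_le_zero.mp this
  have hL : LipschitzOnWith K (Φ ∘ Function.invFunOn Ψ s) (Ψ '' s) := by
    refine LipschitzOnWith.of_dist_le_mul fun a ha b hb => ?_
    have := h _ (Function.invFunOn_mem ha) _ (Function.invFunOn_mem hb)
    rwa [Function.invFunOn_eq ha, Function.invFunOn_eq hb] at this
  rw [key, euclideanHausdorffMeasure_def, euclideanHausdorffMeasure_def, Measure.smul_apply,
    Measure.smul_apply]
  have := hL.hausdorffMeasure_image_le (d := d) (by positivity)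
  rw [ENNReal.rpow_natCast] at this
  calc _ ≤ addHaarScalarFactor (volume : Measure (EuclideanSpace ℝ (Fin d))) μH[d] •
        ((K : ℝ≥0∞) ^ d * μH[d] (Ψ '' s)) := by gcongr
    _ = _ := by rw [ENNReal.smul_def, ENNReal.smul_def, smul_eq_mul, smul_eq_mul]; ring

/-- Countably many of the neighborhoods cover `U`. Making them disjoint and summing preserves the
factor `c`, which then tends to `1`. -/
theorem measure_le_of_locally_le_mul {E : Type*} [TopologicalSpace E] [SecondCountableTopology E]
    [MeasurableSpace E] [OpensMeasurableSpace E] {μ ν : Measure E} {U : Set E}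
    (h : ∀ c : ℝ≥0∞, 1 < c → ∀ x ∈ U, ∃ V, IsOpen V ∧ x ∈ V ∧
      ∀ s ⊆ V ∩ U, MeasurableSet s → μ s ≤ c * ν s)
    {s : Set E} (hsU : s ⊆ U) (hs : MeasurableSet s) : μ s ≤ ν s := by
  have main : ∀ c : ℝ≥0∞, 1 < c → μ s ≤ c * ν s := by
    intro c hc
    rcases U.eq_empty_or_nonempty with rfl | hne
    · simp [Set.subset_empty_iff.mp hsU]
    choose! V hVo hVx hV using h c hc
    obtain ⟨t, htU, htc, ht⟩ := TopologicalSpace.countable_cover_nhdsWithin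
      (f := V) (s := U) fun x hx => mem_nhdsWithin_of_mem_nhds ((hVo x hx).mem_nhds (hVx x hx))
    have hte : t.Nonempty := by
      obtain ⟨x, hx⟩ := hne
      obtain ⟨y, hy, _⟩ := Set.mem_iUnion₂.mp (ht hx)
      exact ⟨y, hy⟩
    obtain ⟨e, he⟩ := htc.exists_eq_range hte
    have heU : ∀ i, e i ∈ U := fun i => htU (he ▸ Set.mem_range_self i)
    have hm : ∀ i, MeasurableSet (disjointed (fun i => V (e i)) i) :=
      MeasurableSet.disjointed fun i => (hVo _ (heU i)).measurableSet
    have hcov : s = ⋃ i, s ∩ disjointed (fun i => V (e i)) i := by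
      rw [← Set.inter_iUnion, iUnion_disjointed, eq_comm, Set.inter_eq_left]
      refine (hsU.trans ht).trans ?_
      rw [he, Set.biUnion_range]
    have hd : Pairwise (Function.onFun Disjoint fun i => s ∩ disjointed (fun i => V (e i)) i) :=
      fun i j hij => (disjoint_disjointed _ hij).mono Set.inter_subset_right Set.inter_subset_right
    rw [hcov, measure_iUnion hd fun i => hs.inter (hm i),
      measure_iUnion hd fun i => hs.inter (hm i), ← ENNReal.tsum_mul_left]
    refine ENNReal.tsum_le_tsum fun i => hV _ (heU i) _ ?_ (hs.inter (hm i))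
    exact fun x hx => ⟨disjointed_subset _ i hx.2, hsU hx.1⟩
  have hlim : Tendsto (fun c : ℝ≥0∞ => c * ν s) (𝓝[>] 1) (𝓝 (1 * ν s)) :=
    (ENNReal.Tendsto.mul_const tendsto_id (Or.inl one_ne_zero)).mono_left nhdsWithin_le_nhds
  rw [one_mul] at hlim
  exact ge_of_tendsto hlim (eventually_nhdsWithin_of_forall main)

/-- Near a point, distances under `Φ` and under its derivative agree up to a factor close to `1`,
and the linear image has measure `J` times volume. The 1-Lipschitz left inverse makes `Φ` expanding,
so an additive linearization error becomes a multiplicative one. Pushing forward by `P` makes the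
formula an equality of measures on `ℝⁿ`. -/
theorem map_restrict_euclideanHausdorffMeasure_image {n : ℕ} {V : Type*} [NormedAddCommGroup V]
    [InnerProductSpace ℝ V] [MeasurableSpace V] [BorelSpace V]
    {U : Set (EuclideanSpace ℝ (Fin n))} (hU : IsOpen U) {Φ : EuclideanSpace ℝ (Fin n) → V}
    {Φ' : EuclideanSpace ℝ (Fin n) → EuclideanSpace ℝ (Fin n) →L[ℝ] V}
    {P : V → EuclideanSpace ℝ (Fin n)} {J : EuclideanSpace ℝ (Fin n) → ℝ}
    (hΦ : ∀ x ∈ U, HasStrictFDerivAt Φ (Φ' x) x) (hP : LipschitzWith 1 P)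
    (hPΦ : ∀ x ∈ U, P (Φ x) = x) (hJc : ContinuousOn J U) (hJpos : ∀ x ∈ U, 0 < J x)
    (hJ : ∀ x ∈ U, (Φ' x).toLinearMap.normDet = J x) (hΦ' : ∀ x ∈ U, ∀ h, ‖h‖ ≤ ‖Φ' x h‖) :
    ((μHE[n] : Measure V).restrict (Φ '' U)).map P =
      (volume.restrict U).withDensity fun x => ENNReal.ofReal (J x) := by
  have hPm : Measurable P := hP.continuous.measurable
  have hμ : ∀ s : Set (EuclideanSpace ℝ (Fin n)), s ⊆ U → MeasurableSet s →
      ((μHE[n] : Measure V).restrict (Φ '' U)).map P s = μHE[n] (Φ '' s) := by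
    intro s hsU hs
    rw [Measure.map_apply hPm hs, Measure.restrict_apply (hPm hs)]
    congr 1
    ext y
    constructor
    · rintro ⟨hy, x, hx, rfl⟩
      rw [Set.mem_preimage, hPΦ x hx] at hy
      exact ⟨x, hy, rfl⟩
    · rintro ⟨x, hx, rfl⟩
      exact ⟨by rw [Set.mem_preimage, hPΦ x (hsU hx)]; exact hx, x, hsU hx, rfl⟩
  have hν : ∀ s : Set (EuclideanSpace ℝ (Fin n)), s ⊆ U → MeasurableSet s →
      (volume.restrict U).withDensity (fun x => ENNReal.ofReal (J x)) s =
        ∫⁻ x in s, ENNReal.ofReal (J x) := by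
    intro s hsU hs
    rw [withDensity_apply _ hs, Measure.restrict_restrict hs, Set.inter_eq_left.mpr hsU]
  have hexp : ∀ x ∈ U, ∀ y ∈ U, dist x y ≤ dist (Φ x) (Φ y) := by
    intro x hx y hy
    have := hP.dist_le_mul (Φ x) (Φ y)
    rwa [hPΦ x hx, hPΦ y hy, NNReal.coe_one, one_mul] at this
  have loc : ∀ c : ℝ≥0∞, 1 < c → ∀ x ∈ U, ∃ V', IsOpen V' ∧ x ∈ V' ∧
      ∀ s ⊆ V' ∩ U, MeasurableSet s →
        μHE[n] (Φ '' s) ≤ c * ∫⁻ x in s, ENNReal.ofReal (J x) ∧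
        ∫⁻ x in s, ENNReal.ofReal (J x) ≤ c * μHE[n] (Φ '' s) := by
    intro c hc x hx
    -- Of the `n + 1` factors, `n` pay for the Lipschitz comparison of `n`-dimensional measures and
    -- one for the oscillation of `J`.
    obtain ⟨K, hK1, hKc⟩ : ∃ K : NNReal, 1 < K ∧ (K : ℝ≥0∞) ^ (n + 1) ≤ c := by
      have hlim : Tendsto (fun K : NNReal => (K : ℝ≥0∞) ^ (n + 1)) (𝓝[>] 1) (𝓝 1) := by
        have : Continuous fun K : NNReal => (K : ℝ≥0∞) ^ (n + 1) := by
          simp_rw [← ENNReal.coe_pow]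
          exact ENNReal.continuous_coe.comp (continuous_pow _)
        have := this.tendsto 1
        simp only [ENNReal.coe_one, one_pow] at this
        exact this.mono_left nhdsWithin_le_nhds
      have h1 := hlim.eventually (eventually_le_nhds hc)
      obtain ⟨K, hK, hK'⟩ := (h1.and self_mem_nhdsWithin).exists
      exact ⟨K, hK', hK⟩
    have hK0 : (0 : NNReal) < K - 1 := tsub_pos_of_lt hK1
    obtain ⟨A', hA', hAlin⟩ := (hΦ x hx).approximates_deriv_on_nhds
      (c := K - 1) (Or.inr hK0)
    obtain ⟨A, hAA', hAo, hxA⟩ := mem_nhds_iff.mp hA'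
    have hJ1 : ∀ᶠ y in 𝓝 x, J y < K * J x := by
      refine (hJc.continuousAt (hU.mem_nhds hx)).eventually (gt_mem_nhds ?_)
      have : (1 : ℝ) < K := by exact_mod_cast hK1
      nlinarith [hJpos x hx]
    have hJ2 : ∀ᶠ y in 𝓝 x, J x < K * J y := by
      refine (((hJc.continuousAt (hU.mem_nhds hx)).const_mul (K : ℝ))).eventually (lt_mem_nhds ?_)
      have : (1 : ℝ) < K := by exact_mod_cast hK1
      nlinarith [hJpos x hx]
    obtain ⟨B, hB, hBo, hxB⟩ := eventually_nhds_iff.mp (hJ1.and hJ2)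
    refine ⟨A ∩ B, hAo.inter hBo, ⟨hxA, hxB⟩, fun s hsV hs => ?_⟩
    have hsA : s ⊆ A := fun y hy => (hsV hy).1.1
    have hsB : s ⊆ B := fun y hy => (hsV hy).1.2
    have hsU : s ⊆ U := fun y hy => (hsV hy).2
    have hKr : ((K - 1 : NNReal) : ℝ) = (K : ℝ) - 1 := by
      rw [NNReal.coe_sub hK1.le, NNReal.coe_one]
    have hdiff : ∀ y ∈ s, ∀ z ∈ s, ‖Φ y - Φ z - Φ' x (y - z)‖ ≤ ((K : ℝ) - 1) * ‖y - z‖ := by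
      intro y hy z hz
      have := hAlin y (hAA' (hsA hy)) z (hAA' (hsA hz))
      rwa [hKr] at this
    have hKr1 : 0 ≤ (K : ℝ) - 1 := by rw [← hKr]; positivity
    have lin : μHE[n] (Φ' x '' s) = ENNReal.ofReal (J x) * volume s := by
      have := (Φ' x).toLinearMap.euclideanHausdorffMeasure_image_eq_normDet_mul_volume s
      rw [finrank_euclideanSpace_fin, hJ x hx] at this
      exact this
    have up : μHE[n] (Φ '' s) ≤ (K : ℝ≥0∞) ^ n * μHE[n] (Φ' x '' s) := by
      refine euclideanHausdorffMeasure_image_le_of_dist_le n fun y hy z hz => ?_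
      have h1 := hdiff y hy z hz
      have h2 := hΦ' x hx (y - z)
      rw [dist_eq_norm, dist_eq_norm, ← map_sub]
      have h3 : ‖Φ y - Φ z‖ ≤ ‖Φ y - Φ z - Φ' x (y - z)‖ + ‖Φ' x (y - z)‖ := by
        simpa using norm_add_le (Φ y - Φ z - Φ' x (y - z)) (Φ' x (y - z))
      nlinarith
    have down : μHE[n] (Φ' x '' s) ≤ (K : ℝ≥0∞) ^ n * μHE[n] (Φ '' s) := by
      refine euclideanHausdorffMeasure_image_le_of_dist_le n fun y hy z hz => ?_
      have h1 := hdiff y hy z hz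
      have h2 := hexp y (hsU hy) z (hsU hz)
      rw [dist_eq_norm, dist_eq_norm] at h2
      rw [dist_eq_norm, dist_eq_norm, ← map_sub]
      have h3 : ‖Φ' x (y - z)‖ ≤ ‖Φ y - Φ z‖ + ‖Φ y - Φ z - Φ' x (y - z)‖ := by
        simpa using norm_sub_le (Φ y - Φ z) (Φ y - Φ z - Φ' x (y - z))
      nlinarith
    have i1 : ENNReal.ofReal (J x) * volume s ≤ K * ∫⁻ y in s, ENNReal.ofReal (J y) := by
      rw [← lintegral_const_mul' _ _ ENNReal.coe_ne_top, ← setLIntegral_const]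
      refine setLIntegral_mono' hs fun y hy => ?_
      rw [← ENNReal.ofReal_coe_nnreal, ← ENNReal.ofReal_mul (by positivity)]
      exact ENNReal.ofReal_le_ofReal (hB y (hsB hy)).2.le
    have i2 : ∫⁻ y in s, ENNReal.ofReal (J y) ≤ K * (ENNReal.ofReal (J x) * volume s) := by
      rw [← mul_assoc, ← setLIntegral_const]
      refine setLIntegral_mono' hs fun y hy => ?_
      rw [← ENNReal.ofReal_coe_nnreal, ← ENNReal.ofReal_mul (by positivity)]
      exact ENNReal.ofReal_le_ofReal (hB y (hsB hy)).1.le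
    constructor
    · calc μHE[n] (Φ '' s) ≤ (K : ℝ≥0∞) ^ n * (ENNReal.ofReal (J x) * volume s) := lin ▸ up
        _ ≤ (K : ℝ≥0∞) ^ n * (K * ∫⁻ y in s, ENNReal.ofReal (J y)) := by gcongr
        _ = (K : ℝ≥0∞) ^ (n + 1) * ∫⁻ y in s, ENNReal.ofReal (J y) := by ring
        _ ≤ _ := by gcongr
    · calc ∫⁻ y in s, ENNReal.ofReal (J y) ≤ K * (ENNReal.ofReal (J x) * volume s) := i2
        _ ≤ K * ((K : ℝ≥0∞) ^ n * μHE[n] (Φ '' s)) := by rw [← lin]; gcongr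
        _ = (K : ℝ≥0∞) ^ (n + 1) * μHE[n] (Φ '' s) := by ring
        _ ≤ _ := by gcongr
  have hUeq : ∀ s : Set (EuclideanSpace ℝ (Fin n)), s ⊆ U → MeasurableSet s →
      ((μHE[n] : Measure V).restrict (Φ '' U)).map P s =
        (volume.restrict U).withDensity (fun x => ENNReal.ofReal (J x)) s := by
    intro s hsU hs
    refine le_antisymm (measure_le_of_locally_le_mul (U := U) ?_ hsU hs)
      (measure_le_of_locally_le_mul (U := U) ?_ hsU hs)
    all_goals
      intro c hc x hx
      obtain ⟨V', hV'o, hxV', h⟩ := loc c hc x hx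
      refine ⟨V', hV'o, hxV', fun s hs hsm => ?_⟩
      have hsU := hs.trans Set.inter_subset_right
      rw [hμ s hsU hsm, hν s hsU hsm]
    · exact (h s hs hsm).1
    · exact (h s hs hsm).2
  ext s hs
  rw [← measure_inter_add_sdiff s hU.measurableSet, ← measure_inter_add_sdiff (μ := withDensity _ _)
    s hU.measurableSet, hUeq _ Set.inter_subset_right (hs.inter hU.measurableSet)]
  congr 1
  rw [Measure.map_apply hPm (hs.diff hU.measurableSet),
    Measure.restrict_apply (hPm (hs.diff hU.measurableSet)),
    withDensity_apply _ (hs.diff hU.measurableSet),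
    Measure.restrict_restrict (hs.diff hU.measurableSet), Set.sdiff_inter_self,
    Measure.restrict_empty, lintegral_zero_measure]
  convert measure_empty (μ := (μHE[n] : Measure V))
  ext y
  simp only [Set.mem_inter_iff, Set.mem_preimage, Set.mem_sdiff, Set.mem_empty_iff_false, iff_false]
  rintro ⟨⟨-, h⟩, x, hx, rfl⟩
  exact h (by rwa [hPΦ x hx])

end AreaFormula

/-! ### Oscillatory integrals with convex phase -/

section Oscillatory

theorem contDiff_of_contDiffAt_tsupport {E F : Type*} [NormedAddCommGroup E] [NormedSpace ℝ E]
    [NormedAddCommGroup F] [NormedSpace ℝ F] {m : WithTop ℕ∞} {f : E → F}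
    (h : ∀ x ∈ tsupport f, ContDiffAt ℝ m f x) : ContDiff ℝ m f := by
  refine contDiff_iff_contDiffAt.mpr fun x => ?_
  by_cases hx : x ∈ tsupport f
  · exact h x hx
  · exact contDiffAt_const.congr_of_eventuallyEq (notMem_tsupport_iff_eventuallyEq.mp hx)

/-- Divergence theorem for the radial field about `x₀`, whose divergence is `n`. -/
theorem integral_fderiv_sub_eq_neg {n : ℕ} {F : Type*} [NormedAddCommGroup F] [NormedSpace ℝ F]
    {h : EuclideanSpace ℝ (Fin n) → F} (hh : ContDiff ℝ 1 h) (hc : HasCompactSupport h)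
    (x₀ : EuclideanSpace ℝ (Fin n)) :
    ∫ x, fderiv ℝ h x (x - x₀) = -((n : ℝ) • ∫ x, h x) := by
  have hcd := hh.continuous_fderiv one_ne_zero
  have hcomp : ∀ (i : Fin n), Continuous fun x : EuclideanSpace ℝ (Fin n) => (x - x₀) i :=
    fun i => by fun_prop
  have hfc : ∀ i : Fin n, HasCompactSupport
      fun x => fderiv ℝ h x (EuclideanSpace.single i (1 : ℝ)) := fun i =>
    (hc.fderiv (𝕜 := ℝ)).mono fun x hx => by
      rw [Function.mem_support] at hx ⊢
      contrapose! hx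
      simp [hx]
  have hint : ∀ i : Fin n, Integrable fun x => (x - x₀) i •
      fderiv ℝ h x (EuclideanSpace.single i (1 : ℝ)) := fun i =>
    Continuous.integrable_of_hasCompactSupport ((hcomp i).smul (by fun_prop)) (hfc i).smul_left
  have hd : ∀ (i : Fin n) x, fderiv ℝ (fun x : EuclideanSpace ℝ (Fin n) => (x - x₀) i) x
      (EuclideanSpace.single i (1 : ℝ)) = 1 := by
    intro i x
    have : HasFDerivAt (fun x : EuclideanSpace ℝ (Fin n) => (x - x₀) i)
        (EuclideanSpace.proj i : EuclideanSpace ℝ (Fin n) →L[ℝ] ℝ) x :=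
      ((EuclideanSpace.proj i : EuclideanSpace ℝ (Fin n) →L[ℝ] ℝ).hasFDerivAt.sub_const (x₀ i))
    rw [this.fderiv]
    simp
  have hpart : ∀ i : Fin n, ∫ x, (x - x₀) i • fderiv ℝ h x (EuclideanSpace.single i (1 : ℝ)) =
      -∫ x, h x := by
    intro i
    rw [integral_smul_fderiv_eq_neg_fderiv_smul_of_integrable (𝕜 := ℝ) _ (hint i)]
    · simp_rw [hd, one_smul]
    · exact Continuous.integrable_of_hasCompactSupport ((hcomp i).smul hh.continuous) hc.smul_left
    · intro x _
      exact ((EuclideanSpace.proj i : EuclideanSpace ℝ (Fin n) →L[ℝ] ℝ).differentiableAt.sub_const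
        (x₀ i))
    · exact fun x _ => hh.differentiable one_ne_zero x
    · simp_rw [hd, one_smul]
      exact hh.continuous.integrable_of_hasCompactSupport hc
  have hsum : ∀ x, fderiv ℝ h x (x - x₀) =
      ∑ i, (x - x₀) i • fderiv ℝ h x (EuclideanSpace.single i (1 : ℝ)) := by
    intro x
    conv_lhs => rw [← (EuclideanSpace.basisFun (Fin n) ℝ).sum_repr (x - x₀)]
    simp
  simp_rw [hsum]
  rw [integral_finsetSum _ fun i _ => hint i]
  simp_rw [hpart]
  simp [Finset.sum_const, Nat.cast_smul_eq_nsmul]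

variable {n : ℕ} {U K : Set (EuclideanSpace ℝ (Fin n))} {g : EuclideanSpace ℝ (Fin n) → ℝ}

/-- Adding the tangent inequalities at `x` and at `x + s • v` shows that the gradient is monotone
along the line; the Hessian term is the limit of its difference quotients. -/
theorem fderiv_fderiv_apply_self_nonneg (hU : IsOpen U) (hg : ContDiffOn ℝ 2 g U)
    (hconv : ∀ x ∈ U, ∀ y ∈ U, g x + fderiv ℝ g x (y - x) ≤ g y)
    {x : EuclideanSpace ℝ (Fin n)} (hx : x ∈ U) (v : EuclideanSpace ℝ (Fin n)) :
    0 ≤ fderiv ℝ (fderiv ℝ g) x v v := by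
  have hD : DifferentiableAt ℝ (fderiv ℝ g) x :=
    ((hg.contDiffAt (hU.mem_nhds hx)).fderiv_right (m := 1) (by norm_num)).differentiableAt
      one_ne_zero
  have hline : HasDerivAt (fun s : ℝ => x + s • v) v 0 := by
    simpa using ((hasDerivAt_id (0 : ℝ)).smul_const v).const_add x
  have h0 : x + (0 : ℝ) • v = x := by simp
  have hφ : HasDerivAt (fun s : ℝ => fderiv ℝ g (x + s • v) v) (fderiv ℝ (fderiv ℝ g) x v v) 0 := by
    have h1 : HasFDerivAt (fderiv ℝ g) (fderiv ℝ (fderiv ℝ g) x) (x + (0 : ℝ) • v) := by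
      rw [h0]; exact hD.hasFDerivAt
    have h2 := h1.comp_hasDerivAt (0 : ℝ) hline
    simpa using h2.clm_apply (hasDerivAt_const (0 : ℝ) v)
  have hnear : ∀ᶠ s : ℝ in 𝓝[≠] 0, x + s • v ∈ U := by
    refine nhdsWithin_le_nhds (hline.continuousAt.eventually_mem ?_)
    rw [h0]; exact hU.mem_nhds hx
  refine ge_of_tendsto (hasDerivAt_iff_tendsto_slope.mp hφ) ?_
  filter_upwards [hnear, self_mem_nhdsWithin] with s hs hs0
  have h1 := hconv x hx _ hs
  have h2 := hconv _ hs x hx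
  have e1 : x + s • v - x = s • v := by abel
  have e2 : x - (x + s • v) = -(s • v) := by abel
  rw [e1, map_smul, smul_eq_mul] at h1
  rw [e2, map_neg, map_smul, smul_eq_mul] at h2
  rw [slope_def_field, h0, sub_zero]
  have hs0' : s ≠ 0 := hs0
  have : (fderiv ℝ g (x + s • v) v - fderiv ℝ g x v) / s =
      (s * fderiv ℝ g (x + s • v) v - s * fderiv ℝ g x v) / s ^ 2 := by field_simp
  rw [this]
  exact div_nonneg (by linarith) (by positivity)

/-- The double integration by parts. `χ` dominates `|η|`, so the signed term `-(Xq) χ` controls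
`|(Xq) η|` and can itself be integrated by parts. The minimizer `x₀` may lie on the boundary of `K`,
since the boundary terms are killed by the supports of `η` and `χ`. -/
theorem norm_integral_exp_mul_le_integral_inv (hU : IsOpen U) (hg : ContDiffOn ℝ 2 g U)
    (hconv : ∀ x ∈ U, ∀ y ∈ U, g x + fderiv ℝ g x (y - x) ≤ g y)
    (hK : IsCompact K) (hKU : K ⊆ U) {x₀ : EuclideanSpace ℝ (Fin n)} (hx₀ : x₀ ∈ K)
    (hmin : ∀ x ∈ K, g x₀ ≤ g x) {η χ : EuclideanSpace ℝ (Fin n) → ℝ}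
    (hη : ContDiff ℝ 1 η) (hχ : ContDiff ℝ 1 χ) (hηK : tsupport η ⊆ K) (hχK : tsupport χ ⊆ K)
    {A : ℝ} (hηχ : ∀ x, |η x| ≤ χ x) (hχA : ∀ x, χ x ≤ A)
    (hη' : ∀ x ∈ K, |fderiv ℝ η x (x - x₀)| ≤ A) (hχ' : ∀ x ∈ K, |fderiv ℝ χ x (x - x₀)| ≤ A)
    {t : ℝ} (ht : 0 < t) :
    ‖∫ x, Complex.exp (Complex.I * ((t * g x : ℝ) : ℂ)) * (η x : ℂ)‖ ≤
      (2 * n + 3) * A * ∫ x in K, (1 + t * (g x - g x₀))⁻¹ := by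
  set D : EuclideanSpace ℝ (Fin n) → ℝ := fun x => fderiv ℝ g x (x - x₀) with hDdef
  set q : EuclideanSpace ℝ (Fin n) → ℝ := fun x => (1 + t * D x)⁻¹ with hqdef
  set e : EuclideanSpace ℝ (Fin n) → ℂ :=
    fun x => Complex.exp (Complex.I * ((t * g x : ℝ) : ℂ)) with hedef
  set Q : EuclideanSpace ℝ (Fin n) → ℝ := fun x => (1 + t * (g x - g x₀))⁻¹ with hQdef
  have hA0 : 0 ≤ A := ((abs_nonneg _).trans (hηχ x₀)).trans (hχA x₀)
  -- The tangent plane at `x`, evaluated at `x₀`.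
  have hDge : ∀ x ∈ K, g x - g x₀ ≤ D x := by
    intro x hx
    have := hconv x (hKU hx) x₀ (hKU hx₀)
    have e1 : x₀ - x = -(x - x₀) := by abel
    rw [e1, map_neg] at this
    simp only [hDdef]; linarith
  have hD0 : ∀ x ∈ K, 0 ≤ D x := fun x hx => by linarith [hDge x hx, hmin x hx]
  have hpos : ∀ x ∈ K, 0 < 1 + t * D x := fun x hx => by
    have := mul_nonneg ht.le (hD0 x hx); linarith
  have hgd : ∀ x ∈ K, ContDiffAt ℝ 2 g x := fun x hx => hg.contDiffAt (hU.mem_nhds (hKU hx))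
  have hfd : ∀ x ∈ K, ContDiffAt ℝ 1 (fderiv ℝ g) x := fun x hx =>
    (hgd x hx).fderiv_right (m := 1) (by norm_num)
  have hDd : ∀ x ∈ K, ContDiffAt ℝ 1 D x := fun x hx =>
    (hfd x hx).clm_apply (contDiffAt_id.sub contDiffAt_const)
  have hqd : ∀ x ∈ K, ContDiffAt ℝ 1 q x := fun x hx =>
    (contDiffAt_const.add (contDiffAt_const.mul (hDd x hx))).inv (hpos x hx).ne'
  have hed : ∀ x ∈ K, ContDiffAt ℝ 1 e x := fun x hx => by
    have h1 : ContDiffAt ℝ 1 (fun x => t * g x) x :=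
      contDiffAt_const.mul ((hgd x hx).of_le (by norm_num))
    exact (contDiffAt_const.mul (Complex.ofRealCLM.contDiff.contDiffAt.comp x h1)).cexp
  -- derivatives along the radial field
  have hDX : ∀ x ∈ K, 0 ≤ fderiv ℝ D x (x - x₀) := by
    intro x hx
    have h1 : HasFDerivAt D _ x := ((hfd x hx).differentiableAt one_ne_zero).hasFDerivAt.clm_apply
      ((hasFDerivAt_id x).sub_const x₀)
    rw [h1.fderiv]
    have h2 := fderiv_fderiv_apply_self_nonneg hU hg hconv (hKU hx) (x - x₀)
    have h3 := hD0 x hx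
    simp only [hDdef] at h3
    simp only [add_apply, ContinuousLinearMap.comp_apply,
      ContinuousLinearMap.flip_apply]
    exact add_nonneg h3 h2
  have hqX : ∀ x ∈ K, fderiv ℝ q x (x - x₀) ≤ 0 := by
    intro x hx
    have h1 : HasFDerivAt q _ x := (hasDerivAt_inv (hpos x hx).ne').comp_hasFDerivAt x
      ((((hDd x hx).differentiableAt one_ne_zero).hasFDerivAt.const_mul t).const_add 1)
    rw [h1.fderiv]
    have := mul_nonneg ht.le (hDX x hx)
    have h4 : 0 ≤ ((1 + t * D x) ^ 2)⁻¹ := by positivity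
    simpa using mul_nonneg h4 this
  have heX : ∀ x ∈ K, fderiv ℝ e x (x - x₀) = Complex.I * ((t * D x : ℝ) : ℂ) * e x := by
    intro x hx
    have h0 : HasFDerivAt (fun x => t * g x) (t • fderiv ℝ g x) x :=
      ((hgd x hx).differentiableAt (by norm_num)).hasFDerivAt.const_mul t
    have h1 : HasFDerivAt e _ x :=
      ((Complex.ofRealCLM.hasFDerivAt.comp x h0).const_mul Complex.I).cexp
    rw [h1.fderiv]
    simp [hedef, hDdef]
    ring
  have hq0 : ∀ x ∈ K, 0 < q x := fun x hx => inv_pos.mpr (hpos x hx)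
  have hQpos : ∀ x ∈ K, 0 < 1 + t * (g x - g x₀) := fun x hx => by
    have := mul_nonneg ht.le (sub_nonneg.mpr (hmin x hx)); linarith
  have hqQ : ∀ x ∈ K, q x ≤ Q x := fun x hx => by
    refine inv_anti₀ (hQpos x hx) ?_
    have := mul_le_mul_of_nonneg_left (hDge x hx) ht.le
    linarith
  have hne : ∀ x, ‖e x‖ = 1 := fun x => by
    simp only [hedef]
    rw [mul_comm]; exact Complex.norm_exp_ofReal_mul_I _
  -- the two test functions
  have cs : ∀ {F : Type} [NormedAddCommGroup F] [NormedSpace ℝ F]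
      {f : EuclideanSpace ℝ (Fin n) → F}, tsupport f ⊆ K → HasCompactSupport f :=
    fun h => hK.of_isClosed_subset (isClosed_tsupport _) h
  set h₁ : EuclideanSpace ℝ (Fin n) → ℂ := fun x => e x * (q x : ℂ) * (η x : ℂ) with hh₁
  set h₂ : EuclideanSpace ℝ (Fin n) → ℝ := fun x => q x * χ x with hh₂
  have ts₁ : tsupport h₁ ⊆ tsupport η := closure_mono fun x hx => by
    rw [Function.mem_support] at hx ⊢
    contrapose! hx
    simp [hh₁, hx]
  have ts₂ : tsupport h₂ ⊆ tsupport χ := closure_mono fun x hx => by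
    rw [Function.mem_support] at hx ⊢
    contrapose! hx
    simp [hh₂, hx]
  have hqc : ∀ x ∈ K, ContDiffAt ℝ 1 (fun x => (q x : ℂ)) x := fun x hx =>
    Complex.ofRealCLM.contDiff.contDiffAt.comp x (hqd x hx)
  have hηc : ContDiff ℝ 1 (fun x => (η x : ℂ)) := Complex.ofRealCLM.contDiff.comp hη
  have cd₁ : ContDiff ℝ 1 h₁ := contDiff_of_contDiffAt_tsupport fun x hx => by
    have hx := hηK (ts₁ hx)
    exact ((hed x hx).mul (hqc x hx)).mul hηc.contDiffAt
  have cd₂ : ContDiff ℝ 1 h₂ := contDiff_of_contDiffAt_tsupport fun x hx => by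
    have hx := hχK (ts₂ hx)
    exact (hqd x hx).mul hχ.contDiffAt
  have cs₁ := cs (ts₁.trans hηK)
  have cs₂ := cs (ts₂.trans hχK)
  have E₁ := integral_fderiv_sub_eq_neg cd₁ cs₁ x₀
  have E₂ := integral_fderiv_sub_eq_neg cd₂ cs₂ x₀
  have cX : Continuous fun x : EuclideanSpace ℝ (Fin n) => x - x₀ := by fun_prop
  have i₁ : Integrable h₁ := cd₁.continuous.integrable_of_hasCompactSupport cs₁
  have i₂ : Integrable h₂ := cd₂.continuous.integrable_of_hasCompactSupport cs₂
  have j₁ : Integrable fun x => fderiv ℝ h₁ x (x - x₀) :=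
    ((cd₁.continuous_fderiv one_ne_zero).clm_apply cX).integrable_of_hasCompactSupport
      ((cs₁.fderiv (𝕜 := ℝ)).mono fun x hx => by
        rw [Function.mem_support] at hx ⊢
        contrapose! hx
        simp [hx])
  have j₂ : Integrable fun x => fderiv ℝ h₂ x (x - x₀) :=
    ((cd₂.continuous_fderiv one_ne_zero).clm_apply cX).integrable_of_hasCompactSupport
      ((cs₂.fderiv (𝕜 := ℝ)).mono fun x hx => by
        rw [Function.mem_support] at hx ⊢
        contrapose! hx
        simp [hx])
  have ie : Integrable fun x => e x * (η x : ℂ) := by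
    have ts : tsupport (fun x => e x * (η x : ℂ)) ⊆ tsupport η := closure_mono fun x hx => by
      rw [Function.mem_support] at hx ⊢
      contrapose! hx
      simp [hx]
    have cd : ContDiff ℝ 1 (fun x => e x * (η x : ℂ)) := contDiff_of_contDiffAt_tsupport fun x hx =>
      (hed x (hηK (ts hx))).mul hηc.contDiffAt
    exact cd.continuous.integrable_of_hasCompactSupport (cs (ts.trans hηK))
  have iQ : IntegrableOn Q K := by
    refine ContinuousOn.integrableOn_compact hK ?_
    refine ContinuousOn.inv₀ ?_ fun x hx => (hQpos x hx).ne'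
    have := hg.continuousOn.mono hKU
    fun_prop
  -- The terms added to `e η`, and all of `W`, are divergences of multiples of the radial field, so
  -- they integrate to zero. Since `t D q = 1 - q`, the derivative of the exponential in `G` cancels
  -- all of `e η` except `q e η`.
  set G : EuclideanSpace ℝ (Fin n) → ℂ := fun x => e x * (η x : ℂ) +
    Complex.I * (fderiv ℝ h₁ x (x - x₀) + (n : ℝ) • h₁ x) with hG
  set W : EuclideanSpace ℝ (Fin n) → ℝ := fun x => fderiv ℝ h₂ x (x - x₀) + (n : ℝ) • h₂ x with hW
  have iW : Integrable W := j₂.add (i₂.smul (n : ℝ))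
  have iG : Integrable G := ie.add ((j₁.add (i₁.smul (n : ℝ))).const_mul Complex.I)
  have eG : ∫ x, G x = ∫ x, e x * (η x : ℂ) := by
    have : G = (fun x => e x * (η x : ℂ)) + fun x => Complex.I *
        ((fun x => fderiv ℝ h₁ x (x - x₀)) + (n : ℝ) • h₁) x := rfl
    rw [this, integral_add' ie ((j₁.add (i₁.smul (n : ℝ))).const_mul Complex.I), integral_const_mul,
      integral_add' j₁ (i₁.smul (n : ℝ)), E₁]
    simp [integral_const_mul]
  have eW : ∫ x, W x = 0 := by
    have : W = (fun x => fderiv ℝ h₂ x (x - x₀)) + (n : ℝ) • h₂ := rfl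
    rw [this, integral_add' j₂ (i₂.smul (n : ℝ)), E₂]
    simp [integral_const_mul]
  have off : ∀ x ∉ K, G x = 0 ∧ W x = 0 := by
    intro x hx
    have a1 : η x = 0 := image_eq_zero_of_notMem_tsupport fun h => hx (hηK h)
    have a2 : χ x = 0 := image_eq_zero_of_notMem_tsupport fun h => hx (hχK h)
    have a3 : fderiv ℝ h₁ x = 0 := fderiv_of_notMem_tsupport ℝ fun h => hx (hηK (ts₁ h))
    have a4 : fderiv ℝ h₂ x = 0 := fderiv_of_notMem_tsupport ℝ fun h => hx (hχK (ts₂ h))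
    simp only [hG, hW, a3, a4]
    simp [hh₁, hh₂, a1, a2]
  -- The term `-(Xq) χ` has no useful pointwise bound, but it cancels when `W` is added. What is
  -- left is `n + 2` terms of size `A q` from `G` and `n + 1` from `W`.
  have pt : ∀ x ∈ K, ‖G x‖ ≤ (2 * n + 3) * A * Q x - W x := by
    intro x hx
    have d1 : fderiv ℝ h₁ x (x - x₀) = Complex.I * ((t * D x : ℝ) : ℂ) * e x * (q x : ℂ) * η x +
        e x * ((fderiv ℝ q x (x - x₀) : ℝ) : ℂ) * η x +
        e x * q x * ((fderiv ℝ η x (x - x₀) : ℝ) : ℂ) := by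
      have b1 := ((hed x hx).differentiableAt one_ne_zero).hasFDerivAt
      have b2 : HasFDerivAt (fun x => (q x : ℂ)) _ x :=
        Complex.ofRealCLM.hasFDerivAt.comp x ((hqd x hx).differentiableAt one_ne_zero).hasFDerivAt
      have b3 : HasFDerivAt (fun x => (η x : ℂ)) _ x :=
        Complex.ofRealCLM.hasFDerivAt.comp x (hη.differentiable one_ne_zero x).hasFDerivAt
      have b4 : HasFDerivAt h₁ _ x := (b1.mul b2).mul b3
      rw [b4.fderiv]
      simp [heX x hx]
      ring
    have d2 : fderiv ℝ h₂ x (x - x₀) = fderiv ℝ q x (x - x₀) * χ x +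
        q x * fderiv ℝ χ x (x - x₀) := by
      have b4 : HasFDerivAt h₂ _ x := ((hqd x hx).differentiableAt one_ne_zero).hasFDerivAt.mul
        (hχ.differentiable one_ne_zero x).hasFDerivAt
      rw [b4.fderiv]
      simp
      ring
    have hq1 : ((t * D x : ℝ) : ℂ) * (q x : ℂ) = 1 - q x := by
      have : t * D x * q x = 1 - q x := by
        have := (hpos x hx).ne'
        simp only [hqdef]; field_simp; ring
      exact_mod_cast congrArg (fun r : ℝ => (r : ℂ)) this
    have eqG : G x = e x * ((((1 : ℝ) * η x * q x : ℝ) : ℂ) + Complex.I *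
        ((fderiv ℝ q x (x - x₀) * η x + q x * fderiv ℝ η x (x - x₀) + n * (q x * η x) : ℝ) : ℂ)) := by
      simp only [hG, d1]
      simp only [hh₁, Complex.real_smul]
      have : Complex.I * (Complex.I * ((t * D x : ℝ) : ℂ) * e x * (q x : ℂ) * η x) =
          - (e x * η x * (1 - q x)) := by
        rw [← hq1]
        linear_combination (((t * D x : ℝ) : ℂ) * e x * (q x : ℂ) * η x) * Complex.I_sq
      generalize ((t * D x : ℝ) : ℂ) = c at this ⊢
      push_cast
      linear_combination this
    have hη1 : |η x| ≤ A := (hηχ x).trans (hχA x)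
    have n1 : ‖G x‖ ≤ |η x| * q x + (-fderiv ℝ q x (x - x₀) * χ x + q x * A + n * (q x * A)) := by
      rw [eqG, norm_mul, hne, one_mul]
      refine (norm_add_le _ _).trans (add_le_add ?_ ?_)
      · rw [Complex.norm_real, Real.norm_eq_abs, one_mul, abs_mul, abs_of_pos (hq0 x hx)]
      · rw [norm_mul, Complex.norm_I, one_mul, Complex.norm_real, Real.norm_eq_abs]
        refine (abs_add_le _ _).trans (add_le_add ((abs_add_le _ _).trans (add_le_add ?_ ?_)) ?_)
        · rw [abs_mul, abs_of_nonpos (hqX x hx)]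
          exact mul_le_mul_of_nonneg_left (hηχ x) (by linarith [hqX x hx])
        · rw [abs_mul, abs_of_pos (hq0 x hx)]
          exact mul_le_mul_of_nonneg_left (hη' x hx) (hq0 x hx).le
        · rw [abs_mul, abs_mul, abs_of_pos (hq0 x hx), Nat.abs_cast]
          gcongr
          exact (hq0 x hx).le
    have n2 : |η x| * q x ≤ A * Q x := mul_le_mul hη1 (hqQ x hx) (hq0 x hx).le hA0
    have n3 : q x * A ≤ A * Q x := by
      rw [mul_comm]; exact mul_le_mul_of_nonneg_left (hqQ x hx) hA0
    have n4 : (n : ℝ) * (q x * A) ≤ n * (A * Q x) := mul_le_mul_of_nonneg_left n3 (by positivity)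
    have n5 : W x ≤ fderiv ℝ q x (x - x₀) * χ x + A * Q x + n * (A * Q x) := by
      simp only [hW, d2, smul_eq_mul]
      change _ + n * (q x * χ x) ≤ _
      have m1 : q x * fderiv ℝ χ x (x - x₀) ≤ q x * A :=
        mul_le_mul_of_nonneg_left ((le_abs_self _).trans (hχ' x hx)) (hq0 x hx).le
      have m2 : (n : ℝ) * (q x * χ x) ≤ n * (q x * A) := by
        have := mul_le_mul_of_nonneg_left (hχA x) (hq0 x hx).le
        gcongr
      linarith
    linarith
  have hKm := hK.measurableSet
  calc ‖∫ x, e x * (η x : ℂ)‖ = ‖∫ x in K, G x‖ := by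
        rw [← eG, setIntegral_eq_integral_of_forall_compl_eq_zero fun x hx => (off x hx).1]
    _ ≤ ∫ x in K, ((2 * n + 3) * A * Q x - W x) := by
        refine norm_integral_le_of_norm_le ((iQ.const_mul _).sub iW.integrableOn) ?_
        exact (ae_restrict_iff' hKm).mpr (ae_of_all _ pt)
    _ = (2 * n + 3) * A * ∫ x in K, Q x := by
        rw [integral_sub (iQ.const_mul _) iW.integrableOn, integral_const_mul,
          setIntegral_eq_integral_of_forall_compl_eq_zero fun x hx => (off x hx).2, eW, sub_zero]

/-- Layer cake: the integrand is at least `τ` only where `g ≤ g x₀ + (τ * t)⁻¹`, and `∫₀¹ τ ^ (-α) =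
1 / (1 - α)`. -/
theorem integral_inv_one_add_mul_le (hK : IsCompact K) (hg : ContinuousOn g K)
    {x₀ : EuclideanSpace ℝ (Fin n)} (hmin : ∀ x ∈ K, g x₀ ≤ g x)
    {α C : ℝ} (hα0 : 0 < α) (hα1 : α < 1) (hC : 0 ≤ C)
    (hcap : ∀ s : ℝ, 0 < s → volume {x ∈ K | g x ≤ g x₀ + s} ≤ ENNReal.ofReal (C * s ^ α))
    {t : ℝ} (ht : 0 < t) :
    ∫ x in K, (1 + t * (g x - g x₀))⁻¹ ≤ C / (1 - α) * t ^ (-α) := by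
  have hQpos : ∀ x ∈ K, 1 ≤ 1 + t * (g x - g x₀) := fun x hx => by
    have := mul_nonneg ht.le (sub_nonneg.mpr (hmin x hx)); linarith
  have hKm := hK.measurableSet
  have iQ : Integrable (fun x => (1 + t * (g x - g x₀))⁻¹) (volume.restrict K) := by
    refine ContinuousOn.integrableOn_compact hK ?_
    refine ContinuousOn.inv₀ ?_ fun x hx => by linarith [hQpos x hx]
    fun_prop
  rw [iQ.integral_eq_integral_Ioc_meas_le (M := 1)]
  · have hint : IntegrableOn (fun τ : ℝ => C * t ^ (-α) * τ ^ (-α)) (Set.Ioc 0 1) := by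
      refine Integrable.const_mul ?_ _
      have := intervalIntegral.intervalIntegrable_rpow' (a := 0) (b := 1) (r := -α) (by linarith)
      rwa [intervalIntegrable_iff_integrableOn_Ioc_of_le zero_le_one] at this
    calc _ ≤ ∫ τ in Set.Ioc (0 : ℝ) 1, C * t ^ (-α) * τ ^ (-α) := by
          refine integral_mono_of_nonneg (ae_of_all _ fun τ => measureReal_nonneg) hint ?_
          refine (ae_restrict_iff' measurableSet_Ioc).mpr (ae_of_all _ fun τ hτ => ?_)
          have hs : 0 < (τ * t)⁻¹ := inv_pos.mpr (mul_pos hτ.1 ht)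
          have h1 : volume.restrict K {x | τ ≤ (1 + t * (g x - g x₀))⁻¹} ≤
              ENNReal.ofReal (C * ((τ * t)⁻¹) ^ α) := by
            refine le_trans ?_ (hcap _ hs)
            rw [Measure.restrict_apply' hKm]
            refine measure_mono fun x hx => ⟨hx.2, ?_⟩
            have h2 := hQpos x hx.2
            have h3 : τ ≤ (1 + t * (g x - g x₀))⁻¹ := hx.1
            have h4 : τ * (1 + t * (g x - g x₀)) ≤ 1 :=
              (le_inv_mul_iff₀' (by linarith)).mp (by rwa [mul_one])
            have h5 : (g x - g x₀) * (τ * t) ≤ 1 := by nlinarith [hτ.1]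
            have := (le_div_iff₀ (mul_pos hτ.1 ht)).mpr h5
            rw [one_div] at this
            linarith
          have h6 : C * ((τ * t)⁻¹) ^ α = C * t ^ (-α) * τ ^ (-α) := by
            rw [Real.inv_rpow (mul_pos hτ.1 ht).le, Real.mul_rpow hτ.1.le ht.le,
              Real.rpow_neg ht.le, Real.rpow_neg hτ.1.le, mul_inv]
            ring
          rw [h6] at h1
          have h7 : 0 ≤ C * t ^ (-α) * τ ^ (-α) := by
            have := hτ.1; positivity
          exact ENNReal.toReal_le_of_le_ofReal h7 h1
      _ = C / (1 - α) * t ^ (-α) := by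
          rw [integral_const_mul, ← intervalIntegral.integral_of_le zero_le_one,
            integral_rpow (Or.inl (by linarith))]
          rw [Real.one_rpow, Real.zero_rpow (by linarith)]
          have : 1 - α ≠ 0 := by linarith
          have : -α + 1 ≠ 0 := by linarith
          field_simp
          ring
  · exact (ae_restrict_iff' hKm).mpr (ae_of_all _ fun x hx =>
      inv_nonneg.mpr (by linarith [hQpos x hx]))
  · exact (ae_restrict_iff' hKm).mpr (ae_of_all _ fun x hx => inv_le_one_of_one_le₀ (hQpos x hx))

end Oscillatory

/-! ### Graph charts -/

section GraphChart

variable {n : ℕ}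

/-- The parametrization `x ↦ A⁻¹ (x, f x)` of a graph placed in space by the rigid motion `A⁻¹`. -/
noncomputable def graphMap
    (A : EuclideanSpace ℝ (Fin (n + 1)) ≃ᵃⁱ[ℝ] WithLp 2 (EuclideanSpace ℝ (Fin n) × ℝ))
    (f : EuclideanSpace ℝ (Fin n) → ℝ) (x : EuclideanSpace ℝ (Fin n)) :
    EuclideanSpace ℝ (Fin (n + 1)) :=
  A.symm (WithLp.toLp 2 (x, f x))

/-- The derivative of `graphMap A f` at a point where `f` has derivative `l`. -/
noncomputable def graphDeriv
    (A : EuclideanSpace ℝ (Fin (n + 1)) ≃ᵃⁱ[ℝ] WithLp 2 (EuclideanSpace ℝ (Fin n) × ℝ))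
    (l : EuclideanSpace ℝ (Fin n) →L[ℝ] ℝ) :
    EuclideanSpace ℝ (Fin n) →L[ℝ] EuclideanSpace ℝ (Fin (n + 1)) :=
  (A.symm.linearIsometryEquiv.toContinuousLinearEquiv :
      WithLp 2 (EuclideanSpace ℝ (Fin n) × ℝ) →L[ℝ] EuclideanSpace ℝ (Fin (n + 1))) ∘L
    ((WithLp.prodContinuousLinearEquiv 2 ℝ (EuclideanSpace ℝ (Fin n)) ℝ).symm :
      EuclideanSpace ℝ (Fin n) × ℝ →L[ℝ] WithLp 2 (EuclideanSpace ℝ (Fin n) × ℝ)) ∘L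
    (ContinuousLinearMap.id ℝ _).prod l

/-- The area density of a graph with derivative `l`. -/
noncomputable def graphDensity (l : EuclideanSpace ℝ (Fin n) →L[ℝ] ℝ) : ℝ :=
  √(1 + ∑ i, l (EuclideanSpace.single i 1) ^ 2)

variable {A : EuclideanSpace ℝ (Fin (n + 1)) ≃ᵃⁱ[ℝ] WithLp 2 (EuclideanSpace ℝ (Fin n) × ℝ)}
  {f : EuclideanSpace ℝ (Fin n) → ℝ}

theorem graphDeriv_apply (l : EuclideanSpace ℝ (Fin n) →L[ℝ] ℝ) (v : EuclideanSpace ℝ (Fin n)) :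
    graphDeriv A l v = A.symm.linearIsometryEquiv (WithLp.toLp 2 (v, l v)) := rfl

theorem isometryEquiv_symm_eq_add (y : WithLp 2 (EuclideanSpace ℝ (Fin n) × ℝ)) :
    A.symm y = A.symm.linearIsometryEquiv y + A.symm 0 := by
  have := A.symm.map_vadd 0 y
  simpa using this

theorem inner_graphDeriv (l : EuclideanSpace ℝ (Fin n) →L[ℝ] ℝ) (u v : EuclideanSpace ℝ (Fin n)) :
    inner ℝ (graphDeriv A l u) (graphDeriv A l v) = inner ℝ u v + l u * l v := by
  rw [graphDeriv_apply, graphDeriv_apply, LinearIsometryEquiv.inner_map_map,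
    WithLp.prod_inner_apply]
  simp [mul_comm]

theorem norm_le_norm_graphDeriv (l : EuclideanSpace ℝ (Fin n) →L[ℝ] ℝ)
    (v : EuclideanSpace ℝ (Fin n)) : ‖v‖ ≤ ‖graphDeriv A l v‖ := by
  have h := inner_graphDeriv (A := A) l v v
  rw [real_inner_self_eq_norm_sq, real_inner_self_eq_norm_sq] at h
  refine abs_le_of_sq_le_sq' ?_ (norm_nonneg _) |>.2
  nlinarith [mul_self_nonneg (l v)]

/-- The Gram matrix is a rank-one perturbation of the identity, so the matrix determinant lemma
applies. -/
theorem normDet_graphDeriv (l : EuclideanSpace ℝ (Fin n) →L[ℝ] ℝ) :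
    (graphDeriv A l).toLinearMap.normDet = graphDensity l := by
  have h := (graphDeriv A l).toLinearMap.normDet_sq_eq_det_gram (EuclideanSpace.basisFun (Fin n) ℝ)
  have hg : Matrix.gram ℝ (fun i => (graphDeriv A l).toLinearMap
      (EuclideanSpace.basisFun (Fin n) ℝ i)) =
      1 + Matrix.replicateCol Unit (fun i => l (EuclideanSpace.single i 1)) *
        Matrix.replicateRow Unit (fun i => l (EuclideanSpace.single i 1)) := by
    ext i j
    rw [Matrix.gram_apply]
    simp only [ContinuousLinearMap.coe_coe]
    rw [inner_graphDeriv]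
    have := orthonormal_iff_ite.mp (EuclideanSpace.basisFun (Fin n) ℝ).orthonormal i j
    rw [this]
    simp [Matrix.one_apply, Matrix.mul_apply, Matrix.replicateCol, Matrix.replicateRow]
  rw [hg, Matrix.det_one_add_replicateCol_mul_replicateRow] at h
  rw [graphDensity, eq_comm, Real.sqrt_eq_iff_eq_sq (by positivity) (LinearMap.normDet_nonneg _)]
  simp only [RCLike.ofReal_real_eq_id, id] at h
  rw [h]
  simp [dotProduct, sq]

theorem one_le_graphDensity (l : EuclideanSpace ℝ (Fin n) →L[ℝ] ℝ) : 1 ≤ graphDensity l := by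
  rw [graphDensity, Real.one_le_sqrt]
  have : 0 ≤ ∑ i, l (EuclideanSpace.single i 1) ^ 2 := Finset.sum_nonneg fun i _ => sq_nonneg _
  linarith

theorem contDiff_graphDensity {m : WithTop ℕ∞} :
    ContDiff ℝ m (graphDensity : (EuclideanSpace ℝ (Fin n) →L[ℝ] ℝ) → ℝ) := by
  refine ContDiff.sqrt ?_ fun l => ?_
  · refine contDiff_const.add (ContDiff.sum fun i _ => ContDiff.pow ?_ 2)
    exact contDiff_id.clm_apply contDiff_const
  · have : 0 ≤ ∑ i, l (EuclideanSpace.single i 1) ^ 2 := Finset.sum_nonneg fun i _ => sq_nonneg _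
    linarith

theorem graphMap_eq : graphMap A f = fun x =>
    A.symm.linearIsometryEquiv (WithLp.toLp 2 (x, f x)) + A.symm 0 :=
  funext fun _ => isometryEquiv_symm_eq_add _

theorem hasStrictFDerivAt_graphMap {l : EuclideanSpace ℝ (Fin n) →L[ℝ] ℝ}
    {x : EuclideanSpace ℝ (Fin n)} (hf : HasStrictFDerivAt f l x) :
    HasStrictFDerivAt (graphMap A f) (graphDeriv A l) x := by
  rw [graphMap_eq]
  have h1 : HasStrictFDerivAt (fun x => (x, f x)) ((ContinuousLinearMap.id ℝ _).prod l) x :=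
    (hasStrictFDerivAt_id x).prodMk hf
  exact (((A.symm.linearIsometryEquiv.toContinuousLinearEquiv :
      WithLp 2 (EuclideanSpace ℝ (Fin n) × ℝ) →L[ℝ] EuclideanSpace ℝ (Fin (n + 1))) ∘L
    ((WithLp.prodContinuousLinearEquiv 2 ℝ (EuclideanSpace ℝ (Fin n)) ℝ).symm :
      EuclideanSpace ℝ (Fin n) × ℝ →L[ℝ]
        WithLp 2 (EuclideanSpace ℝ (Fin n) × ℝ))).hasStrictFDerivAt.comp x h1).add_const _

theorem contDiffAt_graphMap {m : WithTop ℕ∞} {x : EuclideanSpace ℝ (Fin n)}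
    (hf : ContDiffAt ℝ m f x) : ContDiffAt ℝ m (graphMap A f) x := by
  rw [graphMap_eq]
  have h1 : ContDiffAt ℝ m (fun x => (x, f x)) x := contDiffAt_id.prodMk hf
  exact (((A.symm.linearIsometryEquiv.toContinuousLinearEquiv :
      WithLp 2 (EuclideanSpace ℝ (Fin n) × ℝ) →L[ℝ] EuclideanSpace ℝ (Fin (n + 1))) ∘L
    ((WithLp.prodContinuousLinearEquiv 2 ℝ (EuclideanSpace ℝ (Fin n)) ℝ).symm :
      EuclideanSpace ℝ (Fin n) × ℝ →L[ℝ]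
        WithLp 2 (EuclideanSpace ℝ (Fin n) × ℝ))).contDiff.contDiffAt.comp x h1).add
    contDiffAt_const

theorem fst_graphMap (x : EuclideanSpace ℝ (Fin n)) : (A (graphMap A f x)).fst = x := by
  simp [graphMap]

theorem snd_graphMap (x : EuclideanSpace ℝ (Fin n)) : (A (graphMap A f x)).snd = f x := by
  simp [graphMap]

variable (A) in
theorem lipschitzWith_fst : LipschitzWith 1 fun y => (A y).fst := by
  refine LipschitzWith.of_dist_le_mul fun y z => ?_
  rw [NNReal.coe_one, one_mul, ← A.dist_map y z, dist_eq_norm, dist_eq_norm, ← WithLp.sub_fst]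
  refine abs_le_of_sq_le_sq' ?_ (norm_nonneg _) |>.2
  rw [WithLp.prod_norm_sq_eq_of_L2]
  nlinarith [norm_nonneg (A y - A z).snd]

theorem dist_le_dist_graphMap (x y : EuclideanSpace ℝ (Fin n)) :
    dist x y ≤ dist (graphMap A f x) (graphMap A f y) := by
  simpa [fst_graphMap] using (lipschitzWith_fst A).dist_le_mul (graphMap A f x) (graphMap A f y)

/-- Up to an affine function the phase is a multiple of `f`, so the sign of one coefficient decides
whether it is convex or concave. -/
theorem inner_graphMap (v : EuclideanSpace ℝ (Fin (n + 1))) (x : EuclideanSpace ℝ (Fin n)) :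
    inner ℝ v (graphMap A f x) = inner ℝ (A.linearIsometryEquiv v).fst x +
      (A.linearIsometryEquiv v).snd * f x + inner ℝ v (A.symm 0) := by
  rw [graphMap, isometryEquiv_symm_eq_add, inner_add_right]
  congr 1
  have h : A.linearIsometryEquiv (A.symm.linearIsometryEquiv (WithLp.toLp 2 (x, f x))) =
      WithLp.toLp 2 (x, f x) := A.linearIsometryEquiv.apply_symm_apply _
  rw [← LinearIsometryEquiv.inner_map_map A.linearIsometryEquiv, h, WithLp.prod_inner_apply]
  simp [mul_comm]

variable {S : Set (EuclideanSpace ℝ (Fin (n + 1)))}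

theorem IsC2Hypersurface.exists_graphMap (hS : IsC2Hypersurface n S)
    {p : EuclideanSpace ℝ (Fin (n + 1))} (hp : p ∈ S) :
    ∃ (A : EuclideanSpace ℝ (Fin (n + 1)) ≃ᵃⁱ[ℝ] WithLp 2 (EuclideanSpace ℝ (Fin n) × ℝ))
      (f : EuclideanSpace ℝ (Fin n) → ℝ) (r : ℝ), 0 < r ∧ A p = 0 ∧
      ContDiffOn ℝ 2 f (Metric.ball 0 r) ∧ (∀ x ∈ Metric.ball 0 r, graphMap A f x ∈ S) ∧
      ∀ y ∈ S, dist y p < r → graphMap A f (A y).fst = y := by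
  obtain ⟨A, f, hAp, hf, hf0, -, hloc⟩ := hS p hp
  have hΦ0 : graphMap A f 0 = p := by
    rw [graphMap, hf0, ← A.symm_apply_apply p, hAp]; rfl
  obtain ⟨ρ, hρ, hρS⟩ := Metric.eventually_nhds_iff.mp hloc
  have h1 : ∀ᶠ x in 𝓝 (0 : EuclideanSpace ℝ (Fin n)), dist (graphMap A f x) p < ρ := by
    have := (contDiffAt_graphMap (A := A) hf).continuousAt
    rw [ContinuousAt, hΦ0] at this
    exact this.eventually (Metric.ball_mem_nhds p hρ)
  have h2 : ∀ᶠ x in 𝓝 (0 : EuclideanSpace ℝ (Fin n)), ContDiffAt ℝ 2 f x :=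
    hf.eventually (by simp)
  obtain ⟨r, hr, hrB⟩ := Metric.eventually_nhds_iff.mp (h1.and h2)
  refine ⟨A, f, min r ρ, lt_min hr hρ, hAp, fun x hx => ?_, fun x hx => ?_, fun y hy hyp => ?_⟩
  · exact (hrB (lt_of_lt_of_le hx (min_le_left _ _))).2.contDiffWithinAt
  · refine (hρS (hrB (lt_of_lt_of_le hx (min_le_left _ _))).1).mpr ?_
    rw [fst_graphMap, snd_graphMap]
  · have := (hρS (lt_of_lt_of_le hyp (min_le_right _ _))).mp hy
    rw [graphMap, ← this]
    exact A.symm_apply_apply y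

/-- A supporting functional at a graph point is maximal there on the graph, hence vanishes on
tangent vectors and measures only height above the tangent plane. So the whole graph lies weakly on
the side of that plane where a fixed interior point `z` lies strictly. The height `G` of `z` never
vanishes, and by connectedness its sign is the same at all base points. -/
theorem BoundsConvexDomain.exists_sign_tangent_le (hS : BoundsConvexDomain S) {r : ℝ}
    (hf : ContDiffOn ℝ 2 f (Metric.ball 0 r)) (hfS : ∀ x ∈ Metric.ball 0 r, graphMap A f x ∈ S) :
    ∃ σ : ℝ, σ * σ = 1 ∧ ∀ x ∈ Metric.ball 0 r, ∀ y ∈ Metric.ball 0 r,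
      0 ≤ σ * (f y - f x - fderiv ℝ f x (y - x)) := by
  obtain ⟨Ω, ⟨z, hz⟩, hΩo, hΩc, -, rfl⟩ := hS
  set G : EuclideanSpace ℝ (Fin n) → ℝ :=
    fun x => (A z).snd - f x - fderiv ℝ f x ((A z).fst - x) with hG
  have hfd : ∀ x ∈ Metric.ball 0 r, ContDiffAt ℝ 2 f x := fun x hx =>
    hf.contDiffAt (Metric.isOpen_ball.mem_nhds hx)
  have key : ∀ x ∈ Metric.ball 0 r, ∃ c : ℝ, c * G x < 0 ∧
      ∀ y ∈ Metric.ball 0 r, c * (f y - f x - fderiv ℝ f x (y - x)) ≤ 0 := by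
    intro x hx
    have hq : graphMap A f x ∉ Ω := by
      have := hfS x hx
      rw [hΩo.frontier_eq] at this
      exact this.2
    obtain ⟨l, hl⟩ := geometric_hahn_banach_open_point hΩc hΩo hq
    have hlS : ∀ y ∈ frontier Ω, l y ≤ l (graphMap A f x) := fun y hy =>
      closure_minimal (fun a ha => (hl a ha).le) (isClosed_le l.continuous continuous_const)
        (frontier_subset_closure hy)
    have hder : HasFDerivAt (graphMap A f) (graphDeriv A (fderiv ℝ f x)) x :=
      (hasStrictFDerivAt_graphMap ((hfd x hx).hasStrictFDerivAt (by norm_num))).hasFDerivAt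
    have hmax : IsLocalMax (fun y => l (graphMap A f y)) x := by
      filter_upwards [Metric.isOpen_ball.mem_nhds hx] with y hy using hlS _ (hfS y hy)
    have hzero := hmax.hasFDerivAt_eq_zero (l.hasFDerivAt.comp x hder)
    set L := A.symm.linearIsometryEquiv with hL
    have hdec : ∀ (u : EuclideanSpace ℝ (Fin n)) (s : ℝ), l (A.symm (WithLp.toLp 2 (u, s))) -
        l (graphMap A f x) = l (L (WithLp.toLp 2 (0, 1))) * (s - f x - fderiv ℝ f x (u - x)) := by
      intro u s
      have h1 : l (L (WithLp.toLp 2 (u - x, fderiv ℝ f x (u - x)))) = 0 := by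
        have := congrArg (fun T : EuclideanSpace ℝ (Fin n) →L[ℝ] ℝ => T (u - x)) hzero
        simpa [graphDeriv_apply] using this
      rw [graphMap, isometryEquiv_symm_eq_add, isometryEquiv_symm_eq_add (WithLp.toLp 2 (x, f x)),
        ← map_sub, add_sub_add_right_eq_sub, ← map_sub, ← sub_zero (l _), ← h1, ← map_sub,
        ← map_sub, mul_comm, ← smul_eq_mul, ← map_smul, ← map_smul]
      congr 2
      refine WithLp.ofLp_injective 2 ?_
      ext <;> simp
    refine ⟨l (L (WithLp.toLp 2 (0, 1))), ?_, fun y hy => ?_⟩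
    · rw [← hdec]
      have : A.symm (WithLp.toLp 2 ((A z).fst, (A z).snd)) = z := A.symm_apply_apply z
      rw [this]
      linarith [hl z hz]
    · rw [← hdec]
      exact sub_nonpos.mpr (hlS _ (hfS y hy))
  have hGc : ContinuousOn G (Metric.ball 0 r) := fun x hx => by
    have h1 := (hfd x hx).continuousAt
    have h2 : ContinuousAt (fderiv ℝ f) x :=
      ((hfd x hx).fderiv_right (m := 1) (by norm_num)).continuousAt
    exact ((continuousAt_const.sub h1).sub
      (h2.clm_apply (continuousAt_const.sub continuousAt_id))).continuousWithinAt
  have hG0 : ∀ x ∈ Metric.ball 0 r, G x ≠ 0 := fun x hx h => by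
    obtain ⟨c, hc, -⟩ := key x hx
    rw [h, mul_zero] at hc
    exact lt_irrefl _ hc
  have hpre : IsPreconnected (Metric.ball (0 : EuclideanSpace ℝ (Fin n)) r) :=
    (convex_ball _ _).isPreconnected
  by_cases hpos : ∀ x ∈ Metric.ball 0 r, 0 < G x
  · refine ⟨1, by norm_num, fun x hx y hy => ?_⟩
    obtain ⟨c, hc, hcy⟩ := key x hx
    have hc0 : c < 0 := by
      by_contra! h
      exact absurd hc (not_lt.mpr (mul_nonneg h (hpos x hx).le))
    rw [one_mul]
    exact nonneg_of_mul_nonpos_right (hcy y hy) hc0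
  · push Not at hpos
    obtain ⟨a, ha, hGa⟩ := hpos
    have hneg : ∀ x ∈ Metric.ball 0 r, G x < 0 := by
      intro x hx
      by_contra! h
      obtain ⟨b, hb, hb0⟩ := hpre.intermediate_value ha hx hGc ⟨hGa, h⟩
      exact hG0 b hb hb0
    refine ⟨-1, by norm_num, fun x hx y hy => ?_⟩
    obtain ⟨c, hc, hcy⟩ := key x hx
    have hc0 : 0 < c := by
      by_contra! h
      exact absurd hc (not_lt.mpr (mul_nonneg_of_nonpos_of_nonpos h (hneg x hx).le))
    have := nonpos_of_mul_nonpos_right (hcy y hy) hc0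
    linarith

end GraphChart

/-! ### Integration over graph charts -/

section ChartIntegral

variable {n : ℕ}

/-- The point is the order of quantifiers: `M` depends on the amplitude and the radii alone, so it
serves all directions of `ξ` at once. The dominating cutoff is `sup |η|`, or a bound for it, times a
bump equal to `1` on the support of `η`. -/
theorem exists_norm_integral_exp_mul_le {η : EuclideanSpace ℝ (Fin n) → ℝ} (hη : ContDiff ℝ 1 η)
    {ρ R : ℝ} (hρ : 0 < ρ) (hρR : ρ < R) (hηρ : tsupport η ⊆ Metric.closedBall 0 ρ) :
    ∃ M : ℝ, 0 ≤ M ∧ ∀ (U : Set (EuclideanSpace ℝ (Fin n))) (g : EuclideanSpace ℝ (Fin n) → ℝ),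
      IsOpen U → ContDiffOn ℝ 2 g U →
      (∀ x ∈ U, ∀ y ∈ U, g x + fderiv ℝ g x (y - x) ≤ g y) → Metric.closedBall 0 R ⊆ U →
      ∀ x₀ ∈ Metric.closedBall 0 R, (∀ x ∈ Metric.closedBall 0 R, g x₀ ≤ g x) →
      ∀ t : ℝ, 0 < t → ‖∫ x, Complex.exp (Complex.I * ((t * g x : ℝ) : ℂ)) * (η x : ℂ)‖ ≤
        M * ∫ x in Metric.closedBall 0 R, (1 + t * (g x - g x₀))⁻¹ := by
  let b : ContDiffBump (0 : EuclideanSpace ℝ (Fin n)) := ⟨ρ, R, hρ, hρR⟩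
  have hηc : HasCompactSupport η :=
    (isCompact_closedBall 0 ρ).of_isClosed_subset (isClosed_tsupport _) hηρ
  obtain ⟨M₀, hM₀⟩ := hηc.exists_bound_of_continuous hη.continuous
  have hM₀0 : 0 ≤ M₀ := (norm_nonneg _).trans (hM₀ 0)
  set χ : EuclideanSpace ℝ (Fin n) → ℝ := fun x => M₀ * b x with hχdef
  have hχ : ContDiff ℝ 1 χ := contDiff_const.mul b.contDiff
  have hχR : tsupport χ ⊆ Metric.closedBall 0 R := by
    refine (closure_mono fun x hx => ?_).trans b.tsupport_eq.subset
    rw [Function.mem_support] at hx ⊢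
    contrapose! hx
    simp [hχdef, hx]
  have hχc : HasCompactSupport χ :=
    (isCompact_closedBall 0 R).of_isClosed_subset (isClosed_tsupport _) hχR
  obtain ⟨M₁, hM₁⟩ := (hηc.fderiv (𝕜 := ℝ)).exists_bound_of_continuous
    (hη.continuous_fderiv one_ne_zero)
  obtain ⟨M₂, hM₂⟩ := (hχc.fderiv (𝕜 := ℝ)).exists_bound_of_continuous
    (hχ.continuous_fderiv one_ne_zero)
  have hM₁0 : 0 ≤ M₁ := (norm_nonneg _).trans (hM₁ 0)
  have hM₂0 : 0 ≤ M₂ := (norm_nonneg _).trans (hM₂ 0)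
  have hR : 0 < R := hρ.trans hρR
  refine ⟨(2 * n + 3) * (M₀ + M₁ * (2 * R) + M₂ * (2 * R)), by positivity, ?_⟩
  intro U g hU hg hconv hRU x₀ hx₀ hmin t ht
  have hdist : ∀ x ∈ Metric.closedBall (0 : EuclideanSpace ℝ (Fin n)) R, ‖x - x₀‖ ≤ 2 * R := by
    intro x hx
    rw [mem_closedBall_zero_iff] at hx hx₀
    linarith [norm_sub_le x x₀]
  refine norm_integral_exp_mul_le_integral_inv hU hg hconv (isCompact_closedBall 0 R) hRU hx₀ hmin
    hη hχ (hηρ.trans (Metric.closedBall_subset_closedBall hρR.le)) hχR (fun x => ?_) (fun x => ?_)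
    (fun x hx => ?_) (fun x hx => ?_) ht
  · by_cases hx : x ∈ tsupport η
    · have : b x = 1 := b.one_of_mem_closedBall (hηρ hx)
      simp only [hχdef, this, mul_one]
      exact hM₀ x
    · rw [image_eq_zero_of_notMem_tsupport hx, abs_zero]
      exact mul_nonneg hM₀0 b.nonneg
  · have : χ x ≤ M₀ := mul_le_of_le_one_right hM₀0 b.le_one
    have : 0 ≤ M₁ * (2 * R) + M₂ * (2 * R) := by positivity
    linarith
  · have h1 := (fderiv ℝ η x).le_of_opNorm_le_of_le (hM₁ x) (hdist x hx)
    rw [Real.norm_eq_abs] at h1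
    have : 0 ≤ M₂ * (2 * R) := by positivity
    linarith
  · have h1 := (fderiv ℝ χ x).le_of_opNorm_le_of_le (hM₂ x) (hdist x hx)
    rw [Real.norm_eq_abs] at h1
    have : 0 ≤ M₁ * (2 * R) := by positivity
    linarith

variable {A : EuclideanSpace ℝ (Fin (n + 1)) ≃ᵃⁱ[ℝ] WithLp 2 (EuclideanSpace ℝ (Fin n) × ℝ)}
  {f : EuclideanSpace ℝ (Fin n) → ℝ} {U : Set (EuclideanSpace ℝ (Fin n))}

theorem contDiffAt_graphDensity_fderiv {x : EuclideanSpace ℝ (Fin n)} (hf : ContDiffAt ℝ 2 f x) :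
    ContDiffAt ℝ 1 (fun x => graphDensity (fderiv ℝ f x)) x :=
  contDiff_graphDensity.contDiffAt.comp x (hf.fderiv_right (m := 1) (by norm_num))

theorem continuousOn_graphDensity_fderiv (hU : IsOpen U) (hf : ContDiffOn ℝ 2 f U) :
    ContinuousOn (fun x => graphDensity (fderiv ℝ f x)) U := fun _ hx =>
  (contDiffAt_graphDensity_fderiv (hf.contDiffAt (hU.mem_nhds hx))).continuousAt.continuousWithinAt

theorem map_fst_restrict_graphMap_image (hU : IsOpen U) (hf : ContDiffOn ℝ 2 f U) :
    ((μHE[n] : Measure (EuclideanSpace ℝ (Fin (n + 1)))).restrict (graphMap A f '' U)).map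
      (fun y => (A y).fst) =
      (volume.restrict U).withDensity fun x => ENNReal.ofReal (graphDensity (fderiv ℝ f x)) :=
  map_restrict_euclideanHausdorffMeasure_image hU
    (fun x hx => hasStrictFDerivAt_graphMap
      ((hf.contDiffAt (hU.mem_nhds hx)).hasStrictFDerivAt (by norm_num)))
    (lipschitzWith_fst A) (fun x _ => fst_graphMap x) (continuousOn_graphDensity_fderiv hU hf)
    (fun _ _ => one_pos.trans_le (one_le_graphDensity _)) (fun _ _ => normDet_graphDeriv _)
    (fun _ _ => norm_le_norm_graphDeriv _)

theorem continuousOn_graphMap (hU : IsOpen U) (hf : ContDiffOn ℝ 2 f U) :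
    ContinuousOn (graphMap A f) U := fun _ hx =>
  (contDiffAt_graphMap (hf.contDiffAt (hU.mem_nhds hx))).continuousAt.continuousWithinAt

theorem measurableSet_graphMap_image (hU : IsOpen U) (hf : ContDiffOn ℝ 2 f U) :
    MeasurableSet (graphMap A f '' U) :=
  hU.measurableSet.image_of_continuousOn_injOn (continuousOn_graphMap hU hf)
    fun x _ y _ h => by rw [← fst_graphMap (A := A) (f := f) x, h, fst_graphMap]

theorem setIntegral_graphMap_image (hU : IsOpen U) (hf : ContDiffOn ℝ 2 f U)
    {F : EuclideanSpace ℝ (Fin (n + 1)) → ℂ} (hF : ContinuousOn F (graphMap A f '' U)) :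
    ∫ y in graphMap A f '' U, F y ∂μHE[n] =
      ∫ x in U, graphDensity (fderiv ℝ f x) • F (graphMap A f x) := by
  have hJ := continuousOn_graphDensity_fderiv hU hf
  have hFΦ : ContinuousOn (fun x => F (graphMap A f x)) U :=
    hF.comp (continuousOn_graphMap hU hf) (Set.mapsTo_image _ _)
  -- Writing the integrand as a function of the projected point lets the integral pass to the
  -- pushforward measure.
  have h1 : ∫ y in graphMap A f '' U, F y ∂μHE[n] =
      ∫ y in graphMap A f '' U, F (graphMap A f (A y).fst) ∂μHE[n] := by
    refine setIntegral_congr_fun (measurableSet_graphMap_image hU hf) ?_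
    rintro _ ⟨x, -, rfl⟩
    simp only [fst_graphMap]
  have hP : AEMeasurable (fun y => (A y).fst)
      ((μHE[n] : Measure (EuclideanSpace ℝ (Fin (n + 1)))).restrict (graphMap A f '' U)) :=
    (lipschitzWith_fst A).continuous.aemeasurable
  rw [h1, ← integral_map (f := fun x => F (graphMap A f x)) hP,
    map_fst_restrict_graphMap_image hU hf, integral_withDensity_eq_integral_toReal_smul₀]
  · simp_rw [ENNReal.toReal_ofReal (zero_le_one.trans (one_le_graphDensity _))]
  · exact (hJ.aemeasurable hU.measurableSet).ennreal_ofReal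
  · exact ae_of_all _ fun _ => ENNReal.ofReal_lt_top
  · rw [map_fst_restrict_graphMap_image hU hf]
    exact (hFΦ.aestronglyMeasurable hU.measurableSet).mono_ac (withDensity_absolutelyContinuous _ _)

variable {S : Set (EuclideanSpace ℝ (Fin (n + 1)))}

theorem IsC2Hypersurface.isFiniteMeasure_surfaceMeasure (hS : IsC2Hypersurface n S)
    (hSc : IsCompact S) : IsFiniteMeasure (surfaceMeasure S) := by
  refine ⟨?_⟩
  rw [surfaceMeasure, Measure.restrict_apply_univ]
  refine hSc.measure_lt_top_of_nhdsWithin fun p hp => ?_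
  obtain ⟨A, f, r, hr, hAp, hf, -, hloc⟩ := hS.exists_graphMap hp
  refine ⟨S ∩ Metric.ball p (r / 2), inter_mem_nhdsWithin S (Metric.ball_mem_nhds p (by linarith)),
    ?_⟩
  have hsub : Metric.closedBall (0 : EuclideanSpace ℝ (Fin n)) (r / 2) ⊆ Metric.ball 0 r :=
    Metric.closedBall_subset_ball (by linarith)
  calc μHE[n] (S ∩ Metric.ball p (r / 2))
      ≤ ((μHE[n] : Measure (EuclideanSpace ℝ (Fin (n + 1)))).restrict
          (graphMap A f '' Metric.ball 0 r)).map (fun y => (A y).fst)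
          (Metric.closedBall 0 (r / 2)) := by
        rw [Measure.map_apply (lipschitzWith_fst A).continuous.measurable
          Metric.isClosed_closedBall.measurableSet,
          Measure.restrict_apply' (measurableSet_graphMap_image Metric.isOpen_ball hf)]
        refine measure_mono fun y hy => ?_
        have hd := (lipschitzWith_fst A).dist_le_mul y p
        have hyp : dist y p < r / 2 := hy.2
        rw [NNReal.coe_one, one_mul, hAp] at hd
        have hy1 : (A y).fst ∈ Metric.closedBall (0 : EuclideanSpace ℝ (Fin n)) (r / 2) :=
          hd.trans hyp.le
        exact ⟨hy1, (A y).fst, hsub hy1, hloc y hy.1 (by linarith)⟩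
    _ = ∫⁻ x in Metric.closedBall 0 (r / 2), ENNReal.ofReal (graphDensity (fderiv ℝ f x)) := by
        rw [map_fst_restrict_graphMap_image Metric.isOpen_ball hf,
          withDensity_apply _ Metric.isClosed_closedBall.measurableSet,
          Measure.restrict_restrict Metric.isClosed_closedBall.measurableSet,
          Set.inter_eq_left.mpr hsub]
    _ < ⊤ := (((continuousOn_graphDensity_fderiv Metric.isOpen_ball hf).mono
        hsub).integrableOn_compact (isCompact_closedBall _ _)).lintegral_lt_top

theorem IsC1Near.continuousOn {ψ : EuclideanSpace ℝ (Fin (n + 1)) → ℝ} (hψ : IsC1Near S ψ) :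
    ContinuousOn ψ S := by
  obtain ⟨V, -, hSV, h⟩ := hψ
  exact h.continuousOn.mono hSV

theorem continuousOn_exp_inner_mul {ψ : EuclideanSpace ℝ (Fin (n + 1)) → ℝ}
    (hψ : ContinuousOn ψ S) (ξ : EuclideanSpace ℝ (Fin (n + 1))) :
    ContinuousOn (fun x => Complex.exp (-Complex.I * ((inner ℝ ξ x : ℝ) : ℂ)) * (ψ x : ℂ)) S := by
  refine ContinuousOn.mul (Continuous.continuousOn ?_)
    (Complex.continuous_ofReal.comp_continuousOn hψ)
  exact Complex.continuous_exp.comp (continuous_const.mul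
    (Complex.continuous_ofReal.comp (continuous_const.inner continuous_id)))

theorem surfaceFourier_eq_integral_graph (hSm : MeasurableSet S) (hU : IsOpen U)
    (hf : ContDiffOn ℝ 2 f U) (hfS : ∀ x ∈ U, graphMap A f x ∈ S)
    {ψ : EuclideanSpace ℝ (Fin (n + 1)) → ℝ} (hψ : ContinuousOn ψ S)
    (hψ0 : ∀ y ∈ S, y ∉ graphMap A f '' U → ψ y = 0) (ξ : EuclideanSpace ℝ (Fin (n + 1))) :
    surfaceFourier S ψ ξ = ∫ x, Complex.exp (-Complex.I * ((inner ℝ ξ (graphMap A f x) : ℝ) : ℂ)) *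
      ((U.indicator (fun x => graphDensity (fderiv ℝ f x) * ψ (graphMap A f x)) x : ℝ) : ℂ) := by
  have hsub : graphMap A f '' U ⊆ S := Set.image_subset_iff.mpr hfS
  rw [surfaceFourier, surfaceMeasure, setIntegral_eq_of_subset_of_forall_sdiff_eq_zero hSm hsub
    fun y hy => by simp [hψ0 y hy.1 hy.2],
    setIntegral_graphMap_image hU hf ((continuousOn_exp_inner_mul hψ ξ).mono hsub),
    ← integral_indicator hU.measurableSet]
  refine integral_congr_ae (ae_of_all _ fun x => ?_)
  by_cases hx : x ∈ U
  · simp only [Set.indicator_of_mem hx, Complex.real_smul]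
    push_cast
    ring
  · simp [Set.indicator_of_notMem hx]

/-- Projecting the graph to the parameter space does not increase distances, hence does not increase
`n`-dimensional measure. -/
theorem volume_setOf_le_slabMeasure (hSm : MeasurableSet S) {K : Set (EuclideanSpace ℝ (Fin n))}
    (hfS : ∀ x ∈ K, graphMap A f x ∈ S) (v : EuclideanSpace ℝ (Fin (n + 1))) (a : ℝ) {s : ℝ}
    (hs : 0 < s) :
    volume {x ∈ K | a ≤ inner ℝ v (graphMap A f x) ∧ inner ℝ v (graphMap A f x) ≤ a + s} ≤
      slabMeasure S v s⁻¹ := by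
  set T := {x ∈ K | a ≤ inner ℝ v (graphMap A f x) ∧ inner ℝ v (graphMap A f x) ≤ a + s} with hT
  have h1 : (μHE[n] : Measure (EuclideanSpace ℝ (Fin n))) (id '' T) ≤
      ((1 : NNReal) : ℝ≥0∞) ^ n * μHE[n] (graphMap A f '' T) :=
    euclideanHausdorffMeasure_image_le_of_dist_le n fun x _ y _ => by
      simpa using dist_le_dist_graphMap x y
  rw [Set.image_id, EuclideanSpace.euclideanHausdorffMeasure_eq_volume, ENNReal.coe_one, one_pow,
    one_mul] at h1
  refine h1.trans (le_trans ?_ (le_iSup _ a))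
  rw [surfaceMeasure, Measure.restrict_apply' hSm, abs_of_pos (inv_pos.mpr hs), inv_inv]
  refine measure_mono ?_
  rintro _ ⟨x, hx, rfl⟩
  refine ⟨⟨hfS x hx.1, ?_⟩, hfS x hx.1⟩
  rw [real_inner_comm]
  exact hx.2

end ChartIntegral

/-! ### From slab bounds to Fourier decay -/

section FourierDecay

variable {n : ℕ} {S : Set (EuclideanSpace ℝ (Fin (n + 1)))}

/-- The radius is fixed before `ψ`, so that a partition of unity can be built first and its pieces
inserted afterwards. -/
theorem exists_fourierBound_of_support_near (hSm : MeasurableSet S) (hS2 : IsC2Hypersurface n S)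
    (hSc : BoundsConvexDomain S) {p : EuclideanSpace ℝ (Fin (n + 1))} (hp : p ∈ S) :
    ∃ ρ : ℝ, 0 < ρ ∧ ∀ ψ : EuclideanSpace ℝ (Fin (n + 1)) → ℝ, IsC1Near S ψ →
      (∀ y, ρ < dist y p → ψ y = 0) → ∀ α C : ℝ, 0 < α → α < 1 → 0 < C → SlabBound S α C →
      ∃ C' : ℝ, FourierBound S ψ α C' := by
  obtain ⟨A, f, r, hr, hAp, hf, hfS, hloc⟩ := hS2.exists_graphMap hp
  obtain ⟨σ, hσ, hσf⟩ := hSc.exists_sign_tangent_le hf hfS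
  -- Three nested balls: the amplitude lives in radius `r / 4`, the dominating cutoff in `r / 2`,
  -- and the chart in `r`.
  refine ⟨r / 4, by linarith, fun ψ hψ hψ0 α C hα0 hα1 hC hslab => ?_⟩
  set B : Set (EuclideanSpace ℝ (Fin n)) := Metric.ball 0 r with hB
  have hBo : IsOpen B := Metric.isOpen_ball
  have hfd : ∀ x ∈ B, ContDiffAt ℝ 2 f x := fun x hx => hf.contDiffAt (hBo.mem_nhds hx)
  have hPp : ∀ y, dist (A y).fst 0 ≤ dist y p := fun y => by
    have hd := (lipschitzWith_fst A).dist_le_mul y p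
    rw [NNReal.coe_one, one_mul, hAp] at hd
    exact hd
  have hψim : ∀ y ∈ S, y ∉ graphMap A f '' B → ψ y = 0 := by
    intro y hy hyB
    refine hψ0 y ?_
    by_contra! h
    exact hyB ⟨(A y).fst, lt_of_le_of_lt ((hPp y).trans h) (by linarith), hloc y hy (by linarith)⟩
  set η : EuclideanSpace ℝ (Fin n) → ℝ :=
    B.indicator fun x => graphDensity (fderiv ℝ f x) * ψ (graphMap A f x) with hηdef
  have hηs : tsupport η ⊆ Metric.closedBall 0 (r / 4) := by
    refine closure_minimal (fun x hx => ?_) Metric.isClosed_closedBall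
    by_contra h
    refine hx ?_
    have h1 : r / 4 < dist (graphMap A f x) p := by
      have := hPp (graphMap A f x)
      rw [fst_graphMap] at this
      exact (not_le.mp h).trans_le this
    by_cases hxB : x ∈ B
    · rw [hηdef, Set.indicator_of_mem hxB, hψ0 _ h1, mul_zero]
    · rw [hηdef, Set.indicator_of_notMem hxB]
  have hsub4 : Metric.closedBall (0 : EuclideanSpace ℝ (Fin n)) (r / 4) ⊆ B :=
    Metric.closedBall_subset_ball (by linarith)
  have hsub2 : Metric.closedBall (0 : EuclideanSpace ℝ (Fin n)) (r / 2) ⊆ B :=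
    Metric.closedBall_subset_ball (by linarith)
  have hη : ContDiff ℝ 1 η := by
    refine contDiff_of_contDiffAt_tsupport fun x hx => ?_
    have hxB : x ∈ B := hsub4 (hηs hx)
    obtain ⟨V, hVo, hSV, hψV⟩ := hψ
    have h1 : ContDiffAt ℝ 1 (fun x => graphDensity (fderiv ℝ f x) * ψ (graphMap A f x)) x :=
      (contDiffAt_graphDensity_fderiv (hfd x hxB)).mul
        ((hψV.contDiffAt (hVo.mem_nhds (hSV (hfS x hxB)))).comp x
          ((contDiffAt_graphMap (hfd x hxB)).of_le (by norm_num)))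
    refine h1.congr_of_eventuallyEq ?_
    filter_upwards [hBo.mem_nhds hxB] with y hy
    rw [hηdef, Set.indicator_of_mem hy]
  obtain ⟨M, hM0, hM⟩ := exists_norm_integral_exp_mul_le hη (ρ := r / 4) (R := r / 2)
    (by linarith) (by linarith) hηs
  refine ⟨M * (C / (1 - α)), fun ξ hξ => ?_⟩
  have ht : 0 < ‖ξ‖ := norm_pos_iff.mpr hξ
  -- `τ` flips the direction so that the coefficient of `f` in the phase has the sign of `σ`, which
  -- makes the phase convex.
  obtain ⟨τ, hτ, hτσ⟩ : ∃ τ : ℝ, (τ = 1 ∨ τ = -1) ∧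
      0 ≤ τ * (A.linearIsometryEquiv (‖ξ‖⁻¹ • ξ)).snd * σ := by
    rcases le_total 0 ((A.linearIsometryEquiv (‖ξ‖⁻¹ • ξ)).snd * σ) with h | h
    · exact ⟨1, Or.inl rfl, by linarith⟩
    · exact ⟨-1, Or.inr rfl, by linarith⟩
  set v : EuclideanSpace ℝ (Fin (n + 1)) := τ • (‖ξ‖⁻¹ • ξ) with hv
  have hv1 : ‖v‖ = 1 := by
    rw [hv, norm_smul, norm_smul, norm_inv, norm_norm, inv_mul_cancel₀ ht.ne', mul_one]
    rcases hτ with rfl | rfl <;> simp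
  have hξv : ∀ y : EuclideanSpace ℝ (Fin (n + 1)), inner ℝ ξ y = τ * (‖ξ‖ * inner ℝ v y) := by
    intro y
    rw [hv, inner_smul_left, inner_smul_left]
    have : τ * τ = 1 := by rcases hτ with rfl | rfl <;> norm_num
    simp only [conj_trivial]
    field_simp
    linear_combination -(inner ℝ ξ y) * this
  set w := A.linearIsometryEquiv v with hw
  have hwσ : 0 ≤ w.snd * σ := by
    rw [hw, hv, map_smul]
    simpa using hτσ
  set g : EuclideanSpace ℝ (Fin n) → ℝ := fun x => inner ℝ v (graphMap A f x) with hg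
  have hgeq : g = fun x => innerSL ℝ w.fst x + w.snd * f x + inner ℝ v (A.symm 0) :=
    funext fun x => inner_graphMap v x
  have hgC : ContDiffOn ℝ 2 g B := by
    rw [hgeq]
    exact ((innerSL ℝ w.fst).contDiff.contDiffOn.add (contDiffOn_const.mul hf)).add contDiffOn_const
  have hgconv : ∀ x ∈ B, ∀ y ∈ B, g x + fderiv ℝ g x (y - x) ≤ g y := by
    intro x hx y hy
    have h1 : HasFDerivAt g (innerSL ℝ w.fst + w.snd • fderiv ℝ f x) x := by
      rw [hgeq]
      exact ((innerSL ℝ w.fst).hasFDerivAt.add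
        (((hfd x hx).differentiableAt (by norm_num)).hasFDerivAt.const_mul w.snd)).add_const _
    rw [h1.fderiv, hgeq]
    have h2 := mul_nonneg hwσ (hσf x hx y hy)
    have h3 : w.snd * σ * (σ * (f y - f x - fderiv ℝ f x (y - x))) =
        w.snd * (f y - f x - fderiv ℝ f x (y - x)) := by
      linear_combination w.snd * (f y - f x - fderiv ℝ f x (y - x)) * hσ
    rw [h3] at h2
    simp only [add_apply, smul_apply, map_sub, smul_eq_mul] at h2 ⊢
    linarith
  obtain ⟨x₀, hx₀, hmin⟩ := (isCompact_closedBall (0 : EuclideanSpace ℝ (Fin n))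
    (r / 2)).exists_isMinOn ⟨0, Metric.mem_closedBall_self (by linarith)⟩
    (hgC.continuousOn.mono hsub2)
  have hmin' : ∀ x ∈ Metric.closedBall (0 : EuclideanSpace ℝ (Fin n)) (r / 2), g x₀ ≤ g x := hmin
  have main := hM B g hBo hgC hgconv hsub2 x₀ hx₀ hmin' ‖ξ‖ ht
  -- Since `g x₀` is the minimum over the ball, a sublevel set there is the part of the chart in a
  -- slab of width `s`.
  have hcap : ∀ s : ℝ, 0 < s →
      volume {x ∈ Metric.closedBall (0 : EuclideanSpace ℝ (Fin n)) (r / 2) | g x ≤ g x₀ + s} ≤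
        ENNReal.ofReal (C * s ^ α) := by
    intro s hs
    have h1 := volume_setOf_le_slabMeasure (A := A) (f := f) hSm
      (fun x hx => hfS x (hsub2 hx)) v (g x₀) hs
    have h2 := hslab v hv1 s⁻¹ (inv_pos.mpr hs).ne'
    rw [abs_of_pos (inv_pos.mpr hs), Real.inv_rpow hs.le, Real.rpow_neg hs.le, inv_inv] at h2
    refine le_trans (measure_mono fun x hx => ?_) (h1.trans h2)
    exact ⟨hx.1, hmin' x hx.1, hx.2⟩
  have hI := integral_inv_one_add_mul_le (isCompact_closedBall 0 (r / 2))
    (hgC.continuousOn.mono hsub2) hmin' hα0 hα1 hC.le hcap ht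
  have hfour : ‖surfaceFourier S ψ ξ‖ =
      ‖∫ x, Complex.exp (Complex.I * ((‖ξ‖ * g x : ℝ) : ℂ)) * (η x : ℂ)‖ := by
    rw [surfaceFourier_eq_integral_graph hSm hBo hf hfS hψ.continuousOn hψim ξ]
    -- For `τ = 1` the two integrals are complex conjugates, the amplitude being real; for `τ = -1`
    -- they coincide.
    rcases hτ with h | h
    · rw [← Complex.norm_conj, ← integral_conj]
      congr 1
      refine integral_congr_ae (ae_of_all _ fun x => ?_)
      simp only [map_mul, Complex.conj_ofReal, ← Complex.exp_conj, map_neg, Complex.conj_I, neg_neg]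
      rw [hξv, h, one_mul]
    · congr 1
      refine integral_congr_ae (ae_of_all _ fun x => ?_)
      simp only [hξv, h]
      push_cast
      ring_nf
      rfl
  rw [hfour]
  calc _ ≤ _ := main
    _ ≤ M * (C / (1 - α) * ‖ξ‖ ^ (-α)) := by gcongr
    _ = _ := by ring

theorem integrable_exp_inner_mul [IsFiniteMeasure (surfaceMeasure S)] (hSc : IsCompact S)
    {ψ : EuclideanSpace ℝ (Fin (n + 1)) → ℝ} (hψ : ContinuousOn ψ S)
    (ξ : EuclideanSpace ℝ (Fin (n + 1))) :
    Integrable (fun x => Complex.exp (-Complex.I * ((inner ℝ ξ x : ℝ) : ℂ)) * (ψ x : ℂ))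
      (surfaceMeasure S) := by
  have hc := continuousOn_exp_inner_mul hψ ξ
  obtain ⟨M, hM⟩ := hSc.exists_bound_of_continuousOn hc
  refine Integrable.of_bound (hc.aestronglyMeasurable hSc.measurableSet) M ?_
  exact (ae_restrict_iff' hSc.measurableSet).mpr (ae_of_all _ hM)

theorem exists_fourierBound_of_slabBound (hSc : IsCompact S) (hS2 : IsC2Hypersurface n S)
    (hconv : BoundsConvexDomain S) {α C : ℝ} (hα0 : 0 < α) (hα1 : α < 1) (hC : 0 < C)
    (hslab : SlabBound S α C) {ψ : EuclideanSpace ℝ (Fin (n + 1)) → ℝ} (hψ : IsC1Near S ψ) :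
    ∃ C' : ℝ, FourierBound S ψ α C' := by
  have := hS2.isFiniteMeasure_surfaceMeasure hSc
  have hSm := hSc.measurableSet
  choose! ρ hρ0 hρ using fun p (hp : p ∈ S) => exists_fourierBound_of_support_near hSm hS2 hconv hp
  obtain ⟨T, hTS, hcov⟩ := hSc.elim_nhds_subcover (fun p => Metric.ball p (ρ p / 2))
    fun p hp => Metric.ball_mem_nhds p (half_pos (hρ0 p hp))
  have hb : ∀ p : EuclideanSpace ℝ (Fin (n + 1)), ∃ b : EuclideanSpace ℝ (Fin (n + 1)) → ℝ,
      p ∈ S → (ContDiff ℝ 1 b ∧ (∀ x, 0 ≤ b x) ∧ (∀ x ∈ Metric.ball p (ρ p / 2), 0 < b x) ∧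
        ∀ x, ρ p < dist x p → b x = 0) := by
    intro p
    by_cases hp : p ∈ S
    · let b : ContDiffBump p := ⟨ρ p / 2, ρ p, half_pos (hρ0 p hp), half_lt_self (hρ0 p hp)⟩
      refine ⟨b, fun _ => ⟨b.contDiff, fun x => b.nonneg, fun x hx => ?_, fun x hx => ?_⟩⟩
      · exact b.pos_of_mem_ball (Metric.ball_subset_ball (half_le_self (hρ0 p hp).le) hx)
      · exact b.zero_of_le_dist hx.le
    · exact ⟨0, fun h => absurd h hp⟩
  choose b hb using hb
  set β : EuclideanSpace ℝ (Fin (n + 1)) → ℝ := fun x => ∑ p ∈ T, b p x with hβ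
  have hβc : ContDiff ℝ 1 β := ContDiff.sum fun p hp => (hb p (hTS p hp)).1
  have hβpos : ∀ x ∈ S, 0 < β x := by
    intro x hx
    obtain ⟨p, hpT, hxp⟩ := Set.mem_iUnion₂.mp (hcov hx)
    exact Finset.sum_pos' (fun q hq => (hb q (hTS q hq)).2.1 x)
      ⟨p, hpT, (hb p (hTS p hpT)).2.2.1 x hxp⟩
  -- The pieces of `ψ`, with the bumps normalized by their sum `β`. They add up to `ψ` on `S` and
  -- are `C¹` where `ψ` is and `β > 0`, a neighborhood of `S`.
  set φ : EuclideanSpace ℝ (Fin (n + 1)) → EuclideanSpace ℝ (Fin (n + 1)) → ℝ :=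
    fun p x => b p x * (ψ x / β x) with hφ
  have hφ1 : ∀ p ∈ T, IsC1Near S (φ p) := by
    intro p hp
    obtain ⟨V, hVo, hSV, hψV⟩ := hψ
    refine ⟨V ∩ {x | 0 < β x}, hVo.inter (isOpen_lt continuous_const hβc.continuous),
      fun x hx => ⟨hSV hx, hβpos x hx⟩, ?_⟩
    exact (hb p (hTS p hp)).1.contDiffOn.mul ((hψV.mono Set.inter_subset_left).div hβc.contDiffOn
      fun x hx => hx.2.ne')
  have hφB : ∀ p ∈ T, ∃ C' : ℝ, FourierBound S (φ p) α C' := fun p hp =>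
    hρ p (hTS p hp) (φ p) (hφ1 p hp)
      (fun y hy => by simp only [hφ, (hb p (hTS p hp)).2.2.2 y hy, zero_mul]) α C hα0 hα1 hC hslab
  choose! C' hC' using hφB
  refine ⟨∑ p ∈ T, C' p, fun ξ hξ => ?_⟩
  have hsum : surfaceFourier S ψ ξ = ∑ p ∈ T, surfaceFourier S (φ p) ξ := by
    simp only [surfaceFourier]
    rw [← integral_finsetSum _ fun p hp => integrable_exp_inner_mul hSc (hφ1 p hp).continuousOn ξ]
    refine setIntegral_congr_fun hSm fun x hx => ?_
    rw [← Finset.mul_sum, ← Complex.ofReal_sum]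
    congr 2
    simp only [hφ]
    rw [← Finset.sum_mul]
    exact (mul_div_cancel₀ (ψ x) (hβpos x hx).ne').symm
  rw [hsum, Finset.sum_mul]
  exact (norm_sum_le _ _).trans (Finset.sum_le_sum fun p hp => hC' p hp ξ hξ)

end FourierDecay

/-! ### From Fourier decay to slab bounds -/

section SlabBound

theorem integrable_abs_rpow_mul_exp_neg_mul_sq {b : ℝ} (hb : 0 < b) {s : ℝ} (hs : -1 < s) :
    Integrable fun x : ℝ => |x| ^ s * Real.exp (-b * x ^ 2) := by
  have h := integrableOn_rpow_mul_exp_neg_mul_sq hb hs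
  have hpos : IntegrableOn (fun x : ℝ => |x| ^ s * Real.exp (-b * x ^ 2)) (Set.Ioi 0) :=
    h.congr_fun (fun x hx => by simp only [abs_of_pos hx.out]) measurableSet_Ioi
  rw [← integrableOn_univ, ← @Set.Iio_union_Ici _ _ (0 : ℝ), integrableOn_union,
    integrableOn_Ici_iff_integrableOn_Ioi]
  refine ⟨?_, hpos⟩
  rw [← (Measure.measurePreserving_neg (volume : Measure ℝ)).integrableOn_comp_preimage
      (Homeomorph.neg ℝ).measurableEmbedding]
  simpa only [Function.comp_def, neg_sq, abs_neg, Set.neg_preimage, Set.neg_Iio, neg_zero] using hpos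

/-- Fubini and the Fourier transform of a Gaussian; the exponent `1 / 4` is the one whose transform
is a multiple of `exp (-u ^ 2)`. -/
theorem integral_exp_neg_sq_mul_eq {X : Type*} [MeasurableSpace X] {ν : Measure X} [SFinite ν]
    {u ψ : X → ℝ} (hu : Measurable u) (hψ : Integrable ψ ν) :
    ((Real.pi : ℂ) / (1 / 4 : ℂ)) ^ (1 / 2 : ℂ) * ((∫ x, Real.exp (-(u x) ^ 2) * ψ x ∂ν : ℝ) : ℂ) =
      ∫ ξ : ℝ, (Real.exp (-(1 / 4) * ξ ^ 2) : ℂ) *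
        ∫ x, Complex.exp (-Complex.I * ((ξ * u x : ℝ) : ℂ)) * (ψ x : ℂ) ∂ν := by
  have hint : Integrable (Function.uncurry fun (x : X) (ξ : ℝ) =>
      Complex.exp (-Complex.I * ((ξ * u x : ℝ) : ℂ)) *
        ((ψ x : ℂ) * (Real.exp (-(1 / 4) * ξ ^ 2) : ℂ))) (ν.prod volume) := by
    refine (hψ.ofReal.mul_prod (integrable_exp_neg_mul_sq
      (b := 1 / 4) (by norm_num)).ofReal).bdd_mul (c := 1) ?_ (ae_of_all _ fun z => ?_)
    · refine Measurable.aestronglyMeasurable ?_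
      exact Complex.measurable_exp.comp (measurable_const.mul (Complex.measurable_ofReal.comp
        (measurable_snd.mul (hu.comp measurable_fst))))
    · have : -Complex.I * ((z.2 * u z.1 : ℝ) : ℂ) = ((-(z.2 * u z.1) : ℝ) : ℂ) * Complex.I := by
        push_cast; ring
      rw [this, Complex.norm_exp_ofReal_mul_I]
  have hswap := integral_integral_swap hint
  rw [← integral_complex_ofReal, ← integral_const_mul]
  calc _ = ∫ x, (∫ ξ : ℝ, Complex.exp (-Complex.I * ((ξ * u x : ℝ) : ℂ)) *
        ((ψ x : ℂ) * (Real.exp (-(1 / 4) * ξ ^ 2) : ℂ))) ∂ν := by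
        refine integral_congr_ae (ae_of_all _ fun x => ?_)
        have h1 := fourierIntegral_gaussian (b := 1 / 4) (by norm_num) (-(u x : ℂ))
        have h2 : ∫ ξ : ℝ, Complex.exp (-Complex.I * ((ξ * u x : ℝ) : ℂ)) *
            ((ψ x : ℂ) * (Real.exp (-(1 / 4) * ξ ^ 2) : ℂ)) =
            (ψ x : ℂ) * ∫ ξ : ℝ, Complex.exp (Complex.I * -(u x : ℂ) * ξ) *
              Complex.exp (-(1 / 4) * (ξ : ℂ) ^ 2) := by
          rw [← integral_const_mul]
          refine integral_congr_ae (ae_of_all _ fun ξ => ?_)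
          have e1 : -Complex.I * ((ξ * u x : ℝ) : ℂ) = Complex.I * -(u x : ℂ) * ξ := by
            push_cast; ring
          simp only [e1]
          push_cast
          ring
        simp only [h2, h1]
        have e2 : -(-(u x : ℂ)) ^ 2 / (4 * (1 / 4)) = ((-(u x) ^ 2 : ℝ) : ℂ) := by
          push_cast; ring
        rw [e2]
        push_cast
        ring
    _ = _ := by
        rw [hswap]
        refine integral_congr_ae (ae_of_all _ fun ξ => ?_)
        simp only
        rw [← integral_const_mul]
        refine integral_congr_ae (ae_of_all _ fun x => ?_)
        simp only
        ring

variable {n : ℕ} {S : Set (EuclideanSpace ℝ (Fin (n + 1)))}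

theorem exists_slabBound_of_fourierBound [IsFiniteMeasure (surfaceMeasure S)] (hSc : IsCompact S)
    {α C' : ℝ} (hα1 : α < 1) {ψ : EuclideanSpace ℝ (Fin (n + 1)) → ℝ}
    (hψ : ContinuousOn ψ S) (hψ0 : ∀ x ∈ S, 0 < ψ x) (hF : FourierBound S ψ α C') :
    ∃ C : ℝ, 0 < C ∧ SlabBound S α C := by
  have hSm := hSc.measurableSet
  obtain ⟨c, hc0, hc⟩ : ∃ c : ℝ, 0 < c ∧ ∀ x ∈ S, c ≤ ψ x := by
    rcases S.eq_empty_or_nonempty with rfl | hne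
    · exact ⟨1, one_pos, by simp⟩
    · obtain ⟨x, hx, hmin⟩ := hSc.exists_isMinOn hne hψ
      exact ⟨ψ x, hψ0 x hx, hmin⟩
  have hψi : Integrable ψ (surfaceMeasure S) := by
    obtain ⟨M, hM⟩ := hSc.exists_bound_of_continuousOn hψ
    exact Integrable.of_bound (hψ.aestronglyMeasurable hSm) M
      ((ae_restrict_iff' hSm).mpr (ae_of_all _ hM))
  set κ : ℂ := ((Real.pi : ℂ) / (1 / 4 : ℂ)) ^ (1 / 2 : ℂ) with hκdef
  have hκ : 0 < ‖κ‖ := by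
    rw [norm_pos_iff, hκdef, Complex.cpow_ne_zero_iff_of_exponent_ne_zero (by norm_num)]
    simp [Real.pi_ne_zero]
  set Γ : ℝ := ∫ ξ : ℝ, |ξ| ^ (-α) * Real.exp (-(1 / 4) * ξ ^ 2) with hΓ
  have hΓi : Integrable fun ξ : ℝ => |ξ| ^ (-α) * Real.exp (-(1 / 4) * ξ ^ 2) :=
    integrable_abs_rpow_mul_exp_neg_mul_sq (by norm_num) (by linarith)
  have hΓ0 : 0 ≤ Γ := integral_nonneg fun ξ => by positivity
  set k : ℝ := ‖κ‖ * (Real.exp (-1) * c) with hk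
  have hk0 : 0 < k := by positivity
  -- `Γ` bounds the averaged decay, and `k` combines the Gaussian constant, the minimum `exp (-1)`
  -- of the Gaussian on the slab and a lower bound for `ψ`. The `+ 1` only ensures positivity.
  refine ⟨|C'| * Γ / k + 1, by positivity, fun v hv t ht => iSup_le fun s => ?_⟩
  have hT : 0 < |t| := abs_pos.mpr ht
  set u : EuclideanSpace ℝ (Fin (n + 1)) → ℝ := fun x => |t| * (inner ℝ x v - s) with hu
  have huc : Continuous u := continuous_const.mul
    ((continuous_id.inner continuous_const).sub continuous_const)
  have key := integral_exp_neg_sq_mul_eq huc.measurable hψi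
  rw [← hκdef] at key
  -- The position `s` of the slab contributes only a unimodular factor, so the bound is uniform in
  -- `s`.
  have hsf : ∀ ξ : ℝ, ‖∫ x, Complex.exp (-Complex.I * ((ξ * u x : ℝ) : ℂ)) * (ψ x : ℂ)
      ∂surfaceMeasure S‖ = ‖surfaceFourier S ψ ((ξ * |t|) • v)‖ := by
    intro ξ
    have h1 : ∫ x, Complex.exp (-Complex.I * ((ξ * u x : ℝ) : ℂ)) * (ψ x : ℂ) ∂surfaceMeasure S =
        Complex.exp (((ξ * |t| * s : ℝ) : ℂ) * Complex.I) *
          surfaceFourier S ψ ((ξ * |t|) • v) := by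
      rw [surfaceFourier, ← integral_const_mul]
      refine integral_congr_ae (ae_of_all _ fun x => ?_)
      simp only
      rw [← mul_assoc (Complex.exp _) (Complex.exp _), ← Complex.exp_add]
      congr 2
      rw [inner_smul_left, real_inner_comm, hu]
      simp only [conj_trivial]
      push_cast
      ring
    rw [h1, norm_mul, Complex.norm_exp_ofReal_mul_I, one_mul]
  have hupper : ‖κ‖ * ∫ x, Real.exp (-(u x) ^ 2) * ψ x ∂surfaceMeasure S ≤
      |C'| * |t| ^ (-α) * Γ := by
    have h1 : ‖∫ ξ : ℝ, (Real.exp (-(1 / 4) * ξ ^ 2) : ℂ) *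
        ∫ x, Complex.exp (-Complex.I * ((ξ * u x : ℝ) : ℂ)) * (ψ x : ℂ) ∂surfaceMeasure S‖ ≤
        ∫ ξ : ℝ, |C'| * |t| ^ (-α) * (|ξ| ^ (-α) * Real.exp (-(1 / 4) * ξ ^ 2)) := by
      refine norm_integral_le_of_norm_le (hΓi.const_mul _) ?_
      have hne : ∀ᵐ ξ : ℝ, ξ ≠ 0 := by
        rw [ae_iff]; simp
      filter_upwards [hne] with ξ hξ
      have hvξ : (ξ * |t|) • v ≠ 0 := by
        refine smul_ne_zero (mul_ne_zero hξ hT.ne') fun h => ?_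
        rw [h, norm_zero] at hv
        exact zero_ne_one hv
      have h2 := hF _ hvξ
      rw [norm_smul, hv, mul_one, norm_mul, Real.norm_eq_abs, Real.norm_eq_abs, abs_abs,
        Real.mul_rpow (abs_nonneg _) (abs_nonneg _)] at h2
      rw [norm_mul, hsf, Complex.norm_real, Real.norm_eq_abs, abs_of_pos (Real.exp_pos _)]
      calc _ ≤ Real.exp (-(1 / 4) * ξ ^ 2) * (|C'| * (|ξ| ^ (-α) * |t| ^ (-α))) := by
            gcongr
            exact h2.trans (mul_le_mul_of_nonneg_right (le_abs_self _) (by positivity))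
        _ = _ := by ring
    rw [← key, norm_mul, Complex.norm_real, integral_const_mul] at h1
    exact (mul_le_mul_of_nonneg_left (le_abs_self _) hκ.le).trans h1
  set E := {x | x ∈ S ∧ s ≤ inner ℝ x v ∧ inner ℝ x v ≤ s + |t|⁻¹} with hE
  have hEm : MeasurableSet E := by
    have hic : Continuous fun x : EuclideanSpace ℝ (Fin (n + 1)) => (inner ℝ x v : ℝ) :=
      continuous_id.inner continuous_const
    exact hSm.inter ((isClosed_le continuous_const hic).measurableSet.inter
      (isClosed_le hic continuous_const).measurableSet)
  have hGi : Integrable (fun x => Real.exp (-(u x) ^ 2) * ψ x) (surfaceMeasure S) := by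
    refine hψi.bdd_mul (c := 1) (Real.continuous_exp.comp
      (huc.pow 2).neg).aestronglyMeasurable (ae_of_all _ fun x => ?_)
    rw [Real.norm_eq_abs, abs_of_pos (Real.exp_pos _)]
    exact Real.exp_le_one_iff.mpr (by nlinarith [sq_nonneg (u x)])
  have hlower : Real.exp (-1) * c * (surfaceMeasure S).real E ≤
      ∫ x, Real.exp (-(u x) ^ 2) * ψ x ∂surfaceMeasure S := by
    calc _ = ∫ _ in E, Real.exp (-1) * c ∂surfaceMeasure S := by
          rw [setIntegral_const, smul_eq_mul, mul_comm]
      _ ≤ ∫ x in E, Real.exp (-(u x) ^ 2) * ψ x ∂surfaceMeasure S := by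
          refine setIntegral_mono_on (integrable_const _).integrableOn hGi.integrableOn hEm
            fun x hx => ?_
          have h1 : 0 ≤ u x := mul_nonneg hT.le (sub_nonneg.mpr hx.2.1)
          have h2 : u x ≤ 1 := by
            calc u x ≤ |t| * |t|⁻¹ := mul_le_mul_of_nonneg_left (by linarith [hx.2.2]) hT.le
              _ = 1 := mul_inv_cancel₀ hT.ne'
          have h3 : Real.exp (-1) ≤ Real.exp (-(u x) ^ 2) := Real.exp_le_exp.mpr (by nlinarith)
          exact mul_le_mul h3 (hc x hx.1) hc0.le (Real.exp_pos _).le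
      _ ≤ _ := by
          refine setIntegral_le_integral hGi ?_
          exact (ae_restrict_iff' hSm).mpr (ae_of_all _ fun x hx =>
            mul_nonneg (Real.exp_pos _).le (hψ0 x hx).le)
  have hfin : (surfaceMeasure S).real E ≤ (|C'| * Γ / k + 1) * |t| ^ (-α) := by
    have h1 : k * (surfaceMeasure S).real E ≤ |C'| * |t| ^ (-α) * Γ := by
      refine le_trans ?_ hupper
      rw [hk, mul_assoc]
      exact mul_le_mul_of_nonneg_left hlower hκ.le
    have h2 : (surfaceMeasure S).real E ≤ |C'| * |t| ^ (-α) * Γ / k := by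
      rw [le_div_iff₀ hk0]; linarith
    have h3 : 0 ≤ |t| ^ (-α) := by positivity
    calc _ ≤ _ := h2
      _ = |C'| * Γ / k * |t| ^ (-α) := by ring
      _ ≤ _ := by linarith
  rw [← ofReal_measureReal]
  exact ENNReal.ofReal_le_ofReal hfin

end SlabBound

theorem theorem1p4 (n : ℕ) (hn : 1 ≤ n) (S : Set (EuclideanSpace ℝ (Fin (n + 1))))
    (hS_compact : IsCompact S) (hS_C2 : IsC2Hypersurface n S) (hS_convex : BoundsConvexDomain S)
    (α : ℝ) (hα0 : 0 < α) (hα1 : α < 1) :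
    (∀ ψ : EuclideanSpace ℝ (Fin (n + 1)) → ℝ, IsC1Near S ψ →
      (∃ C : ℝ, 0 < C ∧ SlabBound S α C) → ∃ C' : ℝ, FourierBound S ψ α C') ∧
    (∃ C : ℝ, 0 < C ∧ ∀ ψ : EuclideanSpace ℝ (Fin (n + 1)) → ℝ, IsC1Near S ψ →
      (∀ x ∈ S, 0 < ψ x) → (∃ C' : ℝ, FourierBound S ψ α C') → SlabBound S α C) := by
  have := hS_C2.isFiniteMeasure_surfaceMeasure hS_compact
  refine ⟨fun ψ hψ ⟨C, hC, hslab⟩ =>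
    exists_fourierBound_of_slabBound hS_compact hS_C2 hS_convex hα0 hα1 hC hslab hψ, ?_⟩
  -- The slab bound does not mention `ψ`. If some constant works for `S`, it works for every `ψ`; if
  -- none does, no positive `ψ` can have the decay, and any constant will do.
  by_cases h : ∃ C : ℝ, 0 < C ∧ SlabBound S α C
  · obtain ⟨C, hC, hslab⟩ := h
    exact ⟨C, hC, fun _ _ _ _ => hslab⟩
  · refine ⟨1, one_pos, fun ψ hψ hψ0 ⟨C', hC'⟩ => absurd ?_ h⟩
    exact exists_slabBound_of_fourierBound hS_compact hα1 hψ.continuousOn hψ0 hC'
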